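/- All lattices are finite. An element $x$ of a lattice is reducible if $x=y\vee z$ or $x=y\wedge z$ for some $y,z\neq x$; $\mathrm{Red}(L)$ is the set of reducible elements of $L$. The nullity of a poset is $|E|-|V|+(\text{number of components})$ of its cover graph. Let $\mathscr B(j;r,k)$ be the class of all lattices (up to isomorphism) with $j$ elements, in which $0$ and $1$ are reducible, the reducible elements are pairwise comparable and exactly $r$ in number, and which have nullity $k$ (maximal blocks). For a poset $P$, let $\mathrm{Irr}(P)$ be the set of elements with at most one lower and at most one upper cover, and let an element be poset-reducible if it is not in $\mathrm{Irr}(P)$. An element $x$ with exactly one lower and exactly one upper cover is retractible if either there are no poset-reducible $y,z$ with $y\prec x\prec z$, or there are such $y,z$ and $y\prec x\prec z$ is the only directed path of coverings from $y$ to $z$. The basic block associated to $P$ is the poset obtained from $P$ by successively removing retractible elements until none is left, and then successively removing pendant vertices (vertices of degree one in the cover graph) until none is left. $\mathscr B(j;r,k,h)$ is the subclass of $\mathscr B(j;r,k)$ of those lattices whose associated basic block has height $h$ (length of a longest chain). For lattices $L_1,L_2$ and $a<b$ in $L_1$ with $b$ not covering $a$, the adjunct $L_1]_a^bL_2$ is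 $L_1\sqcup L_2$ with the given orders on $L_1$ and $L_2$, where $x\in L_1$ is below all elements of $L_2$ iff $x\le a$, and is above all of them iff $x\ge b$ (and otherwise is incomparable to them). $L_1\oplus L_2$ is the linear sum ($L_1$ below $L_2$). For a five-element chain $C: 0\prec a\prec b\prec c\prec 1$, let $$\begin{aligned} B_1&=C]_0^b\{c_1\}]_a^c\{c_2\}]_a^1\{c_3\}, & B_2&=C]_b^1\{c_1\}]_a^c\{c_2\}]_0^c\{c_3\},\\ B_3&=C]_0^b\{c_1\}]_a^c\{c_2\}]_0^1\{c_3\}, & B_4&=C]_b^1\{c_1\}]_a^c\{c_2\}]_0^1\{c_3\},\\ B_5&=C]_0^b\{c_1\}]_a^c\{c_2\}]_b^1\{c_3\}. && \end{aligned}$$ Let $\mathbb B_i(j;5,3)$ be the class of all members of $\mathscr B(j;5,3)$, up to isomorphism, whose associated basic block is isomorphic to $B_i$. Proposition. Let $j\ge 8$. For each $i\in\{1,2,3,4,5\}$, $$|\mathbb B_i(j;5,3)|=\sum_{s=1}^{j-7}\ \sum_{t=1}^{j-s-6}\binom{j-t-s-2}{4}.$$ Moreover, every $L\in\mathbb B_1(j;5,3)$,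 with reducible elements $0<a<b<c<1$, decomposes as $L=(B'\oplus C')]_a^1C_3$, where $B'=[0,c]\in\mathscr B(i;4,2,3)$ with $i\ge 6$, $C'=(c,1]$ is a chain with $t\ge 1$ elements, $C_3$ is a chain with $s\ge1$ elements, and $i+t+s=j$. -/

import Mathlib

universe u v

/-! ### Reducible elements, nullity, blocks -/

/-- `x` is join-reducible: `x = y ⊔ z` with `y`, `z` both distinct from `x`. -/
def JoinReducible {L : Type u} [Lattice L] (x : L) : Prop :=
  ∃ y z : L, y ≠ x ∧ z ≠ x ∧ y ⊔ z = x

/-- `x` is meet-reducible: `x = y ⊓ z` with `y`, `z` both distinct from `x`. -/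
def MeetReducible {L : Type u} [Lattice L] (x : L) : Prop :=
  ∃ y z : L, y ≠ x ∧ z ≠ x ∧ y ⊓ z = x

/-- The set `Red(L)` of the reducible elements of a lattice. -/
def redSet (L : Type u) [Lattice L] : Set L :=
  {x | JoinReducible x ∨ MeetReducible x}

/-- The nullity of a finite poset: the nullity (cyclomatic number)
`|E| - |V| + (number of connected components)` of its cover graph. -/
noncomputable def posetNullity (P : Type u) [PartialOrder P] : ℤ :=
  (Nat.card (SimpleGraph.hasse P).edgeSet : ℤ) - (Nat.card P : ℤ)
    + (Nat.card (SimpleGraph.hasse P).ConnectedComponent : ℤ)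

/-- A block: a lattice with least and greatest elements, both of which are reducible. -/
def IsBlock (L : Type u) [Lattice L] : Prop :=
  (∃ o : L, IsBot o ∧ o ∈ redSet L) ∧ (∃ e : L, IsTop e ∧ e ∈ redSet L)

/-- `L` is (a representative of) a member of `𝓑(j; r, k)`: a maximal block with `j` elements,
with exactly `r` reducible elements, which are pairwise comparable, and of nullity `k`. -/
def IsMaximalBlock (L : Type u) [Lattice L] (j r k : ℕ) : Prop :=
  0 < j ∧ Nat.card L = j ∧ IsBlock L ∧ IsChain (· ≤ ·) (redSet L) ∧
    (redSet L).ncard = r ∧ posetNullity L = (k : ℤ)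

/-! ### The basic retract and the basic block associated to a poset -/

/-- `Irr(P)`: the elements with at most one lower cover and at most one upper cover. -/
def posetIrr (P : Type u) [PartialOrder P] : Set P :=
  {x | {y | y ⋖ x}.Subsingleton ∧ {y | x ⋖ y}.Subsingleton}

/-- `Red(P)`, the complement of `Irr(P)`. -/
def posetRed (P : Type u) [PartialOrder P] : Set P := (posetIrr P)ᶜ

/-- `Irr*(P)`: the elements with exactly one lower cover and exactly one upper cover. -/
def posetIrrStar (P : Type u) [PartialOrder P] : Set P :=
  {x | (∃! y, y ⋖ x) ∧ (∃! y, x ⋖ y)}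

/-- `l` is a directed path from `y` to `z` in the cover digraph of `P`
(listed by its vertices, going upwards). -/
def IsDirectedPath {P : Type u} [PartialOrder P] (y z : P) (l : List P) : Prop :=
  l.IsChain (· ⋖ ·) ∧ l.head? = some y ∧ l.getLast? = some z

/-- `x ∈ Irr*(P)` is retractible if either there are no reducible `y`, `z` with `y ⋖ x ⋖ z`,
or there are such `y`, `z` and `y ⋖ x ⋖ z` is the only directed path from `y` to `z`. -/
def IsRetractible {P : Type u} [PartialOrder P] (x : P) : Prop :=
  x ∈ posetIrrStar P ∧
    ((¬ ∃ y ∈ posetRed P, ∃ z ∈ posetRed P, y ⋖ x ∧ x ⋖ z) ∨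
      (∃ y ∈ posetRed P, ∃ z ∈ posetRed P, y ⋖ x ∧ x ⋖ z ∧
        ∀ l : List P, IsDirectedPath y z l → l = [y, x, z]))

/-- `x` is a pendant vertex: it has degree one in the cover graph. -/
def IsPendant {P : Type u} [PartialOrder P] (x : P) : Prop :=
  ∃! y, (SimpleGraph.hasse P).Adj x y

/-- `T` is got from `S` (both with the order induced from `P`) by removing one element that is
retractible in the poset `S`. -/
def RetractStep {P : Type u} [PartialOrder P] (S T : Set P) : Prop :=
  ∃ x : S, IsRetractible x ∧ T = S \ {(x : P)}

/-- `T` is got from `S` by removing one pendant vertex of the poset `S`. -/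
def PendantStep {P : Type u} [PartialOrder P] (S T : Set P) : Prop :=
  ∃ x : S, IsPendant x ∧ T = S \ {(x : P)}

/-- The subposet `R` is a basic retract associated to `P`: it is obtained from `P` by successively
removing retractible elements until none is left. -/
def IsBasicRetractOf (P : Type u) [PartialOrder P] (R : Set P) : Prop :=
  Relation.ReflTransGen RetractStep Set.univ R ∧ ∀ x : R, ¬ IsRetractible x

/-- The subposet `S` is a basic block associated to `P`: it is obtained from a basic
retract associated to `P` by successively removing all the pendant vertices. -/
def IsBasicBlockOf (P : Type u) [PartialOrder P] (S : Set P) : Prop :=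
  ∃ R : Set P, IsBasicRetractOf P R ∧ Relation.ReflTransGen PendantStep R S ∧
    ∀ x : S, ¬ IsPendant x

/-- `L` belongs to `𝓑(j; r, k, h)`: it belongs to `𝓑(j; r, k)` and its associated
basic block has height `h`. -/
def IsMaximalBlockOfHeight (L : Type u) [Lattice L] (j r k h : ℕ) : Prop :=
  IsMaximalBlock L j r k ∧
    ∃ S : Set L, IsBasicBlockOf L S ∧ Order.krullDim S = (h : WithBot ℕ∞)

/-! ### Adjuncts and the five basic blocks -/

/-- The underlying set of the adjunct `L₁ ]_a^b L₂`. -/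
def Adjunct (α : Type u) (β : Type v) (_a _b : α) : Type (max u v) := α ⊕ β

namespace Adjunct

variable {α : Type u} {β : Type v} {a b : α}

/-- The inclusion of the first lattice in the adjunct. -/
def inl (x : α) : Adjunct α β a b := Sum.inl x

/-- The inclusion of the second lattice in the adjunct. -/
def inr (x : β) : Adjunct α β a b := Sum.inr x

/-- The order of `L₁ ]_a^b L₂`: the given orders on `L₁` and on `L₂`; an `x` of `L₁` is below
the elements of `L₂` iff `x ≤ a`, and a `y` of `L₁` is above them iff `b ≤ y`. -/
protected def le [LE α] [LE β] : Adjunct α β a b → Adjunct α β a b → Prop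
  | Sum.inl x, Sum.inl y => x ≤ y
  | Sum.inr x, Sum.inr y => x ≤ y
  | Sum.inl x, Sum.inr _ => x ≤ a
  | Sum.inr _, Sum.inl y => b ≤ y

instance [LE α] [LE β] : LE (Adjunct α β a b) := ⟨Adjunct.le⟩

end Adjunct

/-- The condition on the pair `(a, b)` in an adjunct `L₁ ]_a^b L₂`. -/
def IsAdjunctPair {α : Type u} [PartialOrder α] (a b : α) : Prop :=
  a < b ∧ ¬ a ⋖ b

/-- The adjunct `C ]_{a₁}^{b₁} {c₁} ]_{a₂}^{b₂} {c₂} ]_{a₃}^{b₃} {c₃}` of the five-element chain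
`C : 0 ⋖ 1 ⋖ 2 ⋖ 3 ⋖ 4` with three singletons, at pairs of elements of `C`. -/
abbrev TripleAdjunct (a₁ b₁ a₂ b₂ a₃ b₃ : Fin 5) : Type :=
  Adjunct
    (Adjunct (Adjunct (Fin 5) (Fin 1) a₁ b₁) (Fin 1) (Adjunct.inl a₂) (Adjunct.inl b₂))
    (Fin 1) (Adjunct.inl (Adjunct.inl a₃)) (Adjunct.inl (Adjunct.inl b₃))

/-! In the following five, the chain `C` is written `0 ⋖ a ⋖ b ⋖ c ⋖ 1`, that is, the elements
`0, a, b, c, 1` are here `0, 1, 2, 3, 4 : Fin 5`. -/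

/-- `C ]_0^b {c₁} ]_a^c {c₂} ]_a^1 {c₃}` -/
abbrev BasicB₁ : Type := TripleAdjunct 0 2 1 3 1 4

/-- `C ]_b^1 {c₁} ]_a^c {c₂} ]_0^c {c₃}`, the dual of the first -/
abbrev BasicB₂ : Type := TripleAdjunct 2 4 1 3 0 3

/-- `C ]_0^b {c₁} ]_a^c {c₂} ]_0^1 {c₃}` -/
abbrev BasicB₃ : Type := TripleAdjunct 0 2 1 3 0 4

/-- `C ]_b^1 {c₁} ]_a^c {c₂} ]_0^1 {c₃}`, the dual of the third -/
abbrev BasicB₄ : Type := TripleAdjunct 2 4 1 3 0 4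

/-- `C ]_0^b {c₁} ]_a^c {c₂} ]_b^1 {c₃}` -/
abbrev BasicB₅ : Type := TripleAdjunct 0 2 1 3 2 4

/-! ### The classes that are counted -/

/-- `L` is a member of `𝓑(j; 5, 3)` whose associated basic block is (isomorphic to) `B`. -/
def HasBasicBlock (B : Type v) [LE B] (j : ℕ) (L : Type u) [Lattice L] : Prop :=
  IsMaximalBlock L j 5 3 ∧ ∃ S : Set L, IsBasicBlockOf L S ∧ Nonempty (S ≃o B)

/-- Isomorphism of the lattices on `Fin j` that are members of `𝓑(j; 5, 3)` with associated
basic block `B`. -/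
def blockSetoid (B : Type v) [LE B] (j : ℕ) :
    Setoid {L : Lattice (Fin j) // @HasBasicBlock B _ j (Fin j) L} where
  r L M := Nonempty (@OrderIso (Fin j) (Fin j) L.1.toLE M.1.toLE)
  iseqv :=
    { refl := fun L => ⟨@OrderIso.refl (Fin j) L.1.toLE⟩
      symm := fun {L M} ⟨f⟩ => ⟨@OrderIso.symm _ _ L.1.toLE M.1.toLE f⟩
      trans := fun {L M N} ⟨f⟩ ⟨g⟩ => ⟨@OrderIso.trans _ _ _ L.1.toLE M.1.toLE N.1.toLE f g⟩ }

/-- The number of members of `𝓑(j; 5, 3)` with associated basic block `B`, up to isomorphism. -/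
noncomputable def numBlocks (B : Type v) [LE B] (j : ℕ) : ℕ :=
  Nat.card (Quotient (blockSetoid B j))

/-! ### Interval labellings -/

/-! In a block whose reducible elements form a chain `v₀ < ⋯ < v₄`, every other element sits on a
chain hung between two of them, `vᵢ` and `vⱼ`. Label it `(i, j)`, and label `vᵢ` itself `(i, i)`.
Between distinct labels the order is read off the labels: `x ≤ y` iff `hi x ≤ lo y`. Inside one
label it is a chain. So a labelled poset is determined up to isomorphism by its fibre sizes
(`nonempty_orderIso_of_count`). Conversely, once the vertices are the reducible elements, the sizes
are isomorphism invariants (`count_eq_of_orderIso`).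

Call a label long if `i + 1 < j` and short if `i + 1 = j`. An element of a fibre with at least two
members is retractible, and so is the only member of a short fibre. The only member of a long fibre
is not. Retraction therefore ends with exactly one element in each nonempty long fibre and none in
the short ones, and no vertex is ever pendant (`exists_isBasicBlockOf`). Conversely, a labelling of
the basic block can be pulled back through the retractions one at a time: a retractible element sits
between a cover `y ⋖ z` of the smaller poset and inherits its label from `y` and `z`
(`exists_extend`). Hence the basic block is `Bᵢ` exactly when there is a labelling over `Fin 5`
whose nonempty long fibres are the three adjunct pairs of `Bᵢ`. The values 5 and 3 are then
automatic, the nullity being `7 - 5 + 1`.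

What remains is a count of fibre sizes: five vertices, three long fibres of size at least 1, and
four short fibres of any size. The `j - 8` spare elements are distributed over seven fibres in `(j -
2).choose 6` ways (`numBlocks_eq_card`), which is the double sum by two applications of the
hockey-stick identity. Only the number of pairs matters, so the five counts agree.

For `B₁` the long pairs are `(0, 2)`, `(1, 3)`, `(1, 4)`. The fibre over `(1, 4)` is `C₃`, the fibre
over `(3, 4)` together with `v₄` is `(c, 1]`, and everything else lies in `[0, c]`, which is
labelled over `Fin 4`. -/

/-- A labelling of the elements of an ordered set by the intervals `[lo x, hi x]` of the chain
`Fin n`: the elements labelled by one-element intervals form a chain `vtx 0 < vtx 1 < ⋯`, and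
the fibres over the other intervals `[i, j]` are chains placed between `vtx i` and `vtx j`. -/
structure IntervalLabelling (T : Type u) [LE T] (n : ℕ) where
  lo : T → Fin n
  hi : T → Fin n
  lo_le_hi : ∀ x, lo x ≤ hi x
  le_of : ∀ {x y}, hi x ≤ lo y → x ≤ y
  of_le : ∀ {x y}, x ≤ y → hi x ≤ lo y ∨ (lo x = lo y ∧ hi x = hi y)
  total : ∀ {x y}, lo x = lo y → hi x = hi y → x ≤ y ∨ y ≤ x
  vtx : Fin n → T
  lo_vtx : ∀ i, lo (vtx i) = i
  hi_vtx : ∀ i, hi (vtx i) = i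

attribute [simp] IntervalLabelling.lo_vtx IntervalLabelling.hi_vtx

namespace IntervalLabelling

section LE

variable {T : Type u} [LE T] {n : ℕ}

/-- Transport of a labelling along an order isomorphism. -/
def map {T' : Type v} [LE T'] (ℓ : IntervalLabelling T n) (e : T' ≃o T) :
    IntervalLabelling T' n where
  lo x := ℓ.lo (e x)
  hi x := ℓ.hi (e x)
  lo_le_hi x := ℓ.lo_le_hi _
  le_of h := e.le_iff_le.1 (ℓ.le_of h)
  of_le h := ℓ.of_le (e.le_iff_le.2 h)
  total h h' := by simpa using ℓ.total h h'
  vtx i := e.symm (ℓ.vtx i)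
  lo_vtx i := by simp
  hi_vtx i := by simp

/-- The pairs `(i, j)` with `i + 1 < j` over which the fibre is nonempty are those in `P`. -/
def LongSupport (ℓ : IntervalLabelling T n) (P : Finset (Fin n × Fin n)) : Prop :=
  ∀ i j : Fin n, (i, j) ∈ P ↔ (i : ℕ) + 1 < j ∧ ∃ x, ℓ.lo x = i ∧ ℓ.hi x = j

/-- Nonempty fibres are singletons, and the fibres over pairs `(i, i + 1)` are empty. -/
def Basic (ℓ : IntervalLabelling T n) : Prop :=
  (∀ x y, ℓ.lo x = ℓ.lo y → ℓ.hi x = ℓ.hi y → x = y) ∧ ∀ x, (ℓ.lo x : ℕ) + 1 ≠ ℓ.hi x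

theorem LongSupport.map {T' : Type v} [LE T'] {ℓ : IntervalLabelling T n}
    {P : Finset (Fin n × Fin n)} (h : ℓ.LongSupport P) (e : T' ≃o T) :
    (ℓ.map e).LongSupport P := by
  intro i j
  rw [h i j]
  refine and_congr_right fun _ => ⟨?_, ?_⟩
  · rintro ⟨x, hx⟩
    exact ⟨e.symm x, by simpa [IntervalLabelling.map] using hx⟩
  · rintro ⟨x, hx⟩
    exact ⟨e x, hx⟩

theorem Basic.exists_label_iff {ℓ : IntervalLabelling T n} (hb : ℓ.Basic)
    {P : Finset (Fin n × Fin n)} (h : ℓ.LongSupport P) (i j : Fin n) :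
    (∃ x, ℓ.lo x = i ∧ ℓ.hi x = j) ↔ i = j ∨ (i, j) ∈ P := by
  constructor
  · rintro ⟨x, rfl, rfl⟩
    by_cases h' : ℓ.lo x = ℓ.hi x
    · exact .inl h'
    · refine .inr ((h _ _).2 ⟨?_, x, rfl, rfl⟩)
      have h1 := hb.2 x
      have h2 := ℓ.lo_le_hi x
      omega
  · rintro (rfl | h')
    · exact ⟨ℓ.vtx i, by simp⟩
    · exact ((h _ _).1 h').2

/-- A label preserving bijection that is monotone on the fibres is an order isomorphism. -/
theorem le_iff_of_labels {T' : Type v} [LE T'] (ℓ : IntervalLabelling T n)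
    (ℓ' : IntervalLabelling T' n) (f : T → T') (hlo : ∀ x, ℓ'.lo (f x) = ℓ.lo x)
    (hhi : ∀ x, ℓ'.hi (f x) = ℓ.hi x)
    (hf : ∀ x y, ℓ.lo x = ℓ.lo y → ℓ.hi x = ℓ.hi y → (f x ≤ f y ↔ x ≤ y)) (x y : T) :
    f x ≤ f y ↔ x ≤ y := by
  constructor <;> intro h
  · rcases ℓ'.of_le h with h' | ⟨h1, h2⟩
    · exact ℓ.le_of (by simpa [hlo, hhi] using h')
    · rw [hlo, hlo] at h1
      rw [hhi, hhi] at h2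
      exact (hf x y h1 h2).1 h
  · rcases ℓ.of_le h with h' | ⟨h1, h2⟩
    · exact ℓ'.le_of (by simpa [hlo, hhi] using h')
    · exact (hf x y h1 h2).2 h

/-- Basic labelled ordered sets with the same long support are isomorphic. -/
theorem Basic.nonempty_orderIso {T' : Type v} [LE T'] {ℓ : IntervalLabelling T n}
    {ℓ' : IntervalLabelling T' n} (hb : ℓ.Basic) (hb' : ℓ'.Basic) {P : Finset (Fin n × Fin n)}
    (h : ℓ.LongSupport P) (h' : ℓ'.LongSupport P) : Nonempty (T ≃o T') := by
  have key : ∀ x : T, ∃ y : T', ℓ'.lo y = ℓ.lo x ∧ ℓ'.hi y = ℓ.hi x := fun x =>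
    (hb'.exists_label_iff h' _ _).2 ((hb.exists_label_iff h _ _).1 ⟨x, rfl, rfl⟩)
  choose f hlo hhi using key
  have hbij : Function.Bijective f := by
    constructor
    · intro x y hxy
      exact hb.1 x y (by rw [← hlo, ← hlo, hxy]) (by rw [← hhi, ← hhi, hxy])
    · intro y
      obtain ⟨x, hx1, hx2⟩ :=
        (hb.exists_label_iff h _ _).2 ((hb'.exists_label_iff h' _ _).1 ⟨y, rfl, rfl⟩)
      exact ⟨x, hb'.1 _ _ (by rw [hlo, hx1]) (by rw [hhi, hx2])⟩
  refine ⟨⟨Equiv.ofBijective f hbij, ?_⟩⟩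
  intro x y
  refine le_iff_of_labels ℓ ℓ' f hlo hhi ?_ x y
  intro x y h1 h2
  obtain rfl := hb.1 x y h1 h2
  have e1 := ℓ.total (x := x) (y := x) rfl rfl
  have e2 := ℓ'.total (x := f x) (y := f x) rfl rfl
  exact ⟨fun _ => or_self_iff.1 e1, fun _ => or_self_iff.1 e2⟩

end LE

/-! ### Covers and poset-reducible elements of a labelled poset. -/

section PartialOrder

variable {T : Type u} [PartialOrder T] {n : ℕ} (ℓ : IntervalLabelling T n)

theorem eq_vtx {x : T} (h : ℓ.lo x = ℓ.hi x) : x = ℓ.vtx (ℓ.lo x) :=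
  le_antisymm (ℓ.le_of (by simp [h])) (ℓ.le_of (by simp))

theorem lo_eq_hi_iff {x : T} : ℓ.lo x = ℓ.hi x ↔ x ∈ Set.range ℓ.vtx :=
  ⟨fun h => ⟨_, (ℓ.eq_vtx h).symm⟩, by rintro ⟨i, rfl⟩; simp⟩

theorem vtx_le_iff {i : Fin n} {x : T} : ℓ.vtx i ≤ x ↔ i ≤ ℓ.lo x := by
  refine ⟨fun h => ?_, fun h => ℓ.le_of (by simpa using h)⟩
  rcases ℓ.of_le h with h | ⟨h, -⟩ <;> simp at h
  · exact h
  · exact h.le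

theorem le_vtx_iff {i : Fin n} {x : T} : x ≤ ℓ.vtx i ↔ ℓ.hi x ≤ i := by
  refine ⟨fun h => ?_, fun h => ℓ.le_of (by simpa using h)⟩
  rcases ℓ.of_le h with h | ⟨-, h⟩ <;> simp at h
  · exact h
  · exact h.le

theorem vtx_le_vtx {i j : Fin n} : ℓ.vtx i ≤ ℓ.vtx j ↔ i ≤ j := by
  simp [ℓ.vtx_le_iff]

theorem vtx_injective : Function.Injective ℓ.vtx := fun i j h => by
  simpa using congrArg ℓ.lo h

theorem vtx_lt_vtx {i j : Fin n} : ℓ.vtx i < ℓ.vtx j ↔ i < j := by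
  rw [lt_iff_le_not_ge, lt_iff_le_not_ge, ℓ.vtx_le_vtx, ℓ.vtx_le_vtx]

theorem vtx_lo_le (x : T) : ℓ.vtx (ℓ.lo x) ≤ x := ℓ.vtx_le_iff.2 le_rfl

theorem le_vtx_hi (x : T) : x ≤ ℓ.vtx (ℓ.hi x) := ℓ.le_vtx_iff.2 le_rfl

theorem vtx_lo_lt {x : T} (h : ℓ.lo x ≠ ℓ.hi x) : ℓ.vtx (ℓ.lo x) < x :=
  lt_of_le_of_ne (ℓ.vtx_lo_le x) fun h' => h (by rw [← h']; simp)

theorem lt_vtx_hi {x : T} (h : ℓ.lo x ≠ ℓ.hi x) : x < ℓ.vtx (ℓ.hi x) :=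
  lt_of_le_of_ne (ℓ.le_vtx_hi x) fun h' => h (by rw [h']; simp)

theorem lo_mono {x y : T} (h : x ≤ y) : ℓ.lo x ≤ ℓ.lo y :=
  ℓ.vtx_le_iff.1 ((ℓ.vtx_lo_le x).trans h)

theorem hi_mono {x y : T} (h : x ≤ y) : ℓ.hi x ≤ ℓ.hi y :=
  ℓ.le_vtx_iff.1 (h.trans (ℓ.le_vtx_hi y))

/-- If `hi y ≤ lo z`, the vertices at `hi y` and `lo z` both lie between `y` and `z`, so the
covering forces each of them to be `y` or `z`. Otherwise `y` and `z` share a label. -/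
theorem covBy_label {y z : T} (h : y ⋖ z) :
    (ℓ.lo y = ℓ.hi y ∨ ℓ.hi y = ℓ.hi z) ∧ (ℓ.lo z = ℓ.hi z ∨ ℓ.lo y = ℓ.lo z) := by
  rcases ℓ.of_le h.le with h' | h'
  · have h1 : y = ℓ.vtx (ℓ.hi y) ∨ z = ℓ.vtx (ℓ.hi y) := by
      rcases h.eq_or_eq (ℓ.le_vtx_hi y) (ℓ.vtx_le_iff.2 h') with e | e
      exacts [.inl e.symm, .inr e.symm]
    have h2 : y = ℓ.vtx (ℓ.lo z) ∨ z = ℓ.vtx (ℓ.lo z) := by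
      rcases h.eq_or_eq (ℓ.le_vtx_iff.2 h') (ℓ.vtx_lo_le z) with e | e
      exacts [.inl e.symm, .inr e.symm]
    constructor
    · rcases h1 with e | e
      · left
        conv_lhs => rw [e]
        simp
      · right
        conv_rhs => rw [e]
        simp
    · rcases h2 with e | e
      · right
        conv_lhs => rw [e]
        simp
      · left
        conv_rhs => rw [e]
        simp
  · exact ⟨.inr h'.2, .inr h'.1⟩

/-- Elements below a nonvertex that are not in its fibre are below the vertex under it. -/
theorem le_vtx_lo_or {x y : T} (h : y ≤ x) :
    y ≤ ℓ.vtx (ℓ.lo x) ∨ (ℓ.lo y = ℓ.lo x ∧ ℓ.hi y = ℓ.hi x) := by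
  rw [ℓ.le_vtx_iff]
  exact ℓ.of_le h

theorem vtx_hi_le_or {x y : T} (h : x ≤ y) :
    ℓ.vtx (ℓ.hi x) ≤ y ∨ (ℓ.lo x = ℓ.lo y ∧ ℓ.hi x = ℓ.hi y) := by
  rw [ℓ.vtx_le_iff]
  exact ℓ.of_le h

/-- What lies below a nonvertex is a chain inside its fibre, stacked on the down-set of the vertex
`lo x`. This one fact yields both the uniqueness of lower covers and join-irreducibility. -/
theorem comparable_or_le_vtx_of_lt {x y y' : T} (h : y < x) (h' : y' < x) :
    y ≤ y' ∨ y' ≤ y ∨ (y ≤ ℓ.vtx (ℓ.lo x) ∧ y' ≤ ℓ.vtx (ℓ.lo x)) := by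
  rcases ℓ.le_vtx_lo_or h.le with e | e <;> rcases ℓ.le_vtx_lo_or h'.le with e' | e'
  · exact .inr (.inr ⟨e, e'⟩)
  · exact .inl (e.trans (ℓ.vtx_le_iff.2 e'.1.ge))
  · exact .inr (.inl (e'.trans (ℓ.vtx_le_iff.2 e.1.ge)))
  · rcases ℓ.total (e.1.trans e'.1.symm) (e.2.trans e'.2.symm) with h | h
    exacts [.inl h, .inr (.inl h)]

theorem comparable_or_vtx_le_of_gt {x y y' : T} (h : x < y) (h' : x < y') :
    y ≤ y' ∨ y' ≤ y ∨ (ℓ.vtx (ℓ.hi x) ≤ y ∧ ℓ.vtx (ℓ.hi x) ≤ y') := by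
  rcases ℓ.vtx_hi_le_or h.le with e | e <;> rcases ℓ.vtx_hi_le_or h'.le with e' | e'
  · exact .inr (.inr ⟨e, e'⟩)
  · exact .inr (.inl (le_trans (ℓ.le_vtx_iff.2 e'.2.ge) e))
  · exact .inl (le_trans (ℓ.le_vtx_iff.2 e.2.ge) e')
  · rcases ℓ.total (e.1.symm.trans e'.1) (e.2.symm.trans e'.2) with h | h
    exacts [.inl h, .inr (.inl h)]

theorem covBy_left_unique {x y y' : T} (hx : ℓ.lo x ≠ ℓ.hi x) (h : y ⋖ x) (h' : y' ⋖ x) :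
    y = y' := by
  rcases ℓ.comparable_or_le_vtx_of_lt h.lt h'.lt with e | e | ⟨e, e'⟩
  · by_contra hne
    exact h.2 (lt_of_le_of_ne e hne) h'.lt
  · by_contra hne
    exact h'.2 (lt_of_le_of_ne e (Ne.symm hne)) h.lt
  · have hv := ℓ.vtx_lo_lt hx
    rw [(h.eq_or_eq e hv.le).resolve_right hv.ne |>.symm,
      (h'.eq_or_eq e' hv.le).resolve_right hv.ne |>.symm]

theorem covBy_right_unique {x y y' : T} (hx : ℓ.lo x ≠ ℓ.hi x) (h : x ⋖ y) (h' : x ⋖ y') :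
    y = y' := by
  rcases ℓ.comparable_or_vtx_le_of_gt h.lt h'.lt with e | e | ⟨e, e'⟩
  · by_contra hne
    exact h'.2 h.lt (lt_of_le_of_ne e hne)
  · by_contra hne
    exact h.2 h'.lt (lt_of_le_of_ne e (Ne.symm hne))
  · have hv := ℓ.lt_vtx_hi hx
    rw [(h.eq_or_eq hv.le e).resolve_left hv.ne' |>.symm,
      (h'.eq_or_eq hv.le e').resolve_left hv.ne' |>.symm]

theorem not_mem_posetRed {x : T} (hx : ℓ.lo x ≠ ℓ.hi x) : x ∉ posetRed T := by
  simp only [posetRed, Set.mem_compl_iff, not_not]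
  exact ⟨fun _ h _ h' => ℓ.covBy_left_unique hx h h',
    fun _ h _ h' => ℓ.covBy_right_unique hx h h'⟩

variable [Finite T]

theorem mem_posetIrrStar {x : T} (hx : ℓ.lo x ≠ ℓ.hi x) : x ∈ posetIrrStar T := by
  obtain ⟨y, -, hy⟩ := exists_le_covBy_of_lt (ℓ.vtx_lo_lt hx)
  obtain ⟨z, hz, -⟩ := exists_covBy_le_of_lt (ℓ.lt_vtx_hi hx)
  exact ⟨⟨y, hy, fun _ h => ℓ.covBy_left_unique hx h hy⟩,
    ⟨z, hz, fun _ h => ℓ.covBy_right_unique hx h hz⟩⟩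

/-- Every element of the chain `Fin n` is an end of a pair in `P`. -/
def Spanning {n : ℕ} (P : Finset (Fin n × Fin n)) : Prop :=
  ∀ i, ∃ p ∈ P, p.1 = i ∨ p.2 = i

variable {ℓ} {P : Finset (Fin n × Fin n)}

/-- One cover starts towards the fibre over `(i, j)`, the other towards vertex `i + 1`. They differ
because an element above `vtx i` and below a member of that fibre has `hi = j > i + 1`. -/
theorem exists_upper_covers (h : ℓ.LongSupport P) {i j : Fin n} (hp : (i, j) ∈ P) :
    ∃ y z, y ≠ z ∧ ℓ.vtx i ⋖ y ∧ ℓ.vtx i ⋖ z := by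
  obtain ⟨hij, x, rfl, rfl⟩ := (h _ _).1 hp
  have hx : ℓ.lo x ≠ ℓ.hi x := fun e => by rw [e] at hij; omega
  let k : Fin n := ⟨ℓ.lo x + 1, by omega⟩
  have hk : ℓ.lo x < k := by simp [k, Fin.lt_def]
  obtain ⟨y, hy, hyx⟩ := exists_covBy_le_of_lt (ℓ.vtx_lo_lt hx)
  obtain ⟨z, hz, hzx⟩ := exists_covBy_le_of_lt (ℓ.vtx_lt_vtx.2 hk)
  refine ⟨y, z, ?_, hy, hz⟩
  rintro rfl
  rcases ℓ.le_vtx_lo_or hyx with e | e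
  · exact absurd (hy.lt.trans_le e) (lt_irrefl _)
  · have := ℓ.hi_mono hzx
    rw [e.2, hi_vtx, Fin.le_def] at this
    simp only [k] at this
    omega

theorem exists_lower_covers (h : ℓ.LongSupport P) {i j : Fin n} (hp : (i, j) ∈ P) :
    ∃ y z, y ≠ z ∧ y ⋖ ℓ.vtx j ∧ z ⋖ ℓ.vtx j := by
  obtain ⟨hij, x, rfl, rfl⟩ := (h _ _).1 hp
  have hx : ℓ.lo x ≠ ℓ.hi x := fun e => by rw [e] at hij; omega
  let k : Fin n := ⟨ℓ.hi x - 1, by omega⟩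
  have hk : k < ℓ.hi x := by simp only [k, Fin.lt_def]; omega
  obtain ⟨y, hyx, hy⟩ := exists_le_covBy_of_lt (ℓ.lt_vtx_hi hx)
  obtain ⟨z, hzx, hz⟩ := exists_le_covBy_of_lt (ℓ.vtx_lt_vtx.2 hk)
  refine ⟨y, z, ?_, hy, hz⟩
  rintro rfl
  rcases ℓ.vtx_hi_le_or hyx with e | e
  · exact absurd (e.trans_lt hy.lt) (lt_irrefl _)
  · have := ℓ.lo_mono hzx
    rw [← e.1, lo_vtx, Fin.le_def] at this
    simp only [k] at this
    omega

theorem vtx_mem_posetRed (h : ℓ.LongSupport P) (hP : Spanning P) (i : Fin n) :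
    ℓ.vtx i ∈ posetRed T := by
  rintro ⟨h1, h2⟩
  obtain ⟨⟨a, b⟩, hp, rfl | rfl⟩ := hP i
  · obtain ⟨y, z, hyz, hy, hz⟩ := exists_upper_covers h hp
    exact hyz (h2 hy hz)
  · obtain ⟨y, z, hyz, hy, hz⟩ := exists_lower_covers h hp
    exact hyz (h1 hy hz)

theorem mem_posetRed_iff (h : ℓ.LongSupport P) (hP : Spanning P) {x : T} :
    x ∈ posetRed T ↔ ℓ.lo x = ℓ.hi x := by
  refine ⟨fun hx => ?_, fun hx => ?_⟩
  · by_contra hne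
    exact ℓ.not_mem_posetRed hne hx
  · rw [ℓ.eq_vtx hx]
    exact vtx_mem_posetRed h hP _

end PartialOrder

end IntervalLabelling

/-! ### Directed paths and retractible elements -/

section Paths

variable {T : Type u} [PartialOrder T]

theorem IsDirectedPath.cons {w y z : T} {l : List T} (h : w ⋖ y) (hl : IsDirectedPath y z l) :
    IsDirectedPath w z (w :: l) := by
  obtain ⟨h1, h2, h3⟩ := hl
  cases l with
  | nil => simp at h2
  | cons a l =>
    simp only [List.head?_cons, Option.some.injEq] at h2
    subst h2
    exact ⟨List.isChain_cons_cons.2 ⟨h, h1⟩, rfl, by simpa using h3⟩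

theorem le_of_reflTransGen_covBy {y z : T} (h : Relation.ReflTransGen (· ⋖ ·) y z) : y ≤ z := by
  induction h with
  | refl => exact le_rfl
  | tail _ h ih => exact ih.trans h.le

variable [Finite T]

theorem reflTransGen_covBy_of_le {y z : T} (h : y ≤ z) : Relation.ReflTransGen (· ⋖ ·) y z := by
  classical
  have := Fintype.ofFinite T
  let : LocallyFiniteOrder T := Fintype.toLocallyFiniteOrder
  exact le_iff_reflTransGen_covBy.1 h

theorem IsDirectedPath.exists_extend {w y z : T} {l : List T} (h : w ≤ y)
    (hl : IsDirectedPath y z l) : ∃ l', IsDirectedPath w z l' ∧ l ⊆ l' := by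
  induction reflTransGen_covBy_of_le h using Relation.ReflTransGen.head_induction_on with
  | refl => exact ⟨l, hl, fun _ h => h⟩
  | head h1 h2 ih =>
    obtain ⟨l', hl', hs⟩ := ih (le_of_reflTransGen_covBy h2)
    exact ⟨_, hl'.cons h1, fun _ h => List.mem_cons_of_mem _ (hs h)⟩

theorem exists_isDirectedPath_mem {y u z : T} (h : y ≤ u) (h' : u ≤ z) :
    ∃ l, IsDirectedPath y z l ∧ u ∈ l := by
  have h0 : IsDirectedPath z z [z] := ⟨by simp, rfl, rfl⟩
  obtain ⟨l, hl, -⟩ := h0.exists_extend h'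
  obtain ⟨l', hl', hs⟩ := hl.exists_extend h
  exact ⟨l', hl', hs (List.mem_of_mem_head? (by rw [hl.2.1]; rfl))⟩

/-- A retractible element has a lower cover `y` and an upper cover `z` that are comparable with
everything comparable with it, and there is nothing else between `y` and `z`. -/
theorem IsRetractible.exists_covers {x : T} (hx : IsRetractible x) :
    ∃ y z, y ⋖ x ∧ x ⋖ z ∧ (∀ u, u < x → u ≤ y) ∧ (∀ u, x < u → z ≤ u) ∧
      ∀ u, y < u → u < z → u = x := by
  obtain ⟨⟨⟨y, hy, hy'⟩, ⟨z, hz, hz'⟩⟩, hx⟩ := hx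
  have h1 : ∀ u, u < x → u ≤ y := fun u hu => by
    obtain ⟨w, hw, hwx⟩ := exists_le_covBy_of_lt hu
    exact hw.trans (hy' w hwx).le
  have h2 : ∀ u, x < u → z ≤ u := fun u hu => by
    obtain ⟨w, hxw, hw⟩ := exists_covBy_le_of_lt hu
    exact (hz' w hxw).ge.trans hw
  refine ⟨y, z, hy, hz, h1, h2, fun u hu hu' => ?_⟩
  rcases hx with hx | ⟨y', -, z', -, hyx, hxz, hpath⟩
  -- With no reducible pair around `x`, either `z` has `x` as its only lower cover or `y` has `x` as
  -- its only upper cover. Any `u` strictly between `y` and `z` is then comparable with `x`, hence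
  -- equal to it.
  · by_cases hyr : y ∈ posetRed T
    · have hzr : z ∈ posetIrr T := by
        by_contra hzr
        exact hx ⟨y, hyr, z, hzr, hy, hz⟩
      obtain ⟨w, hw, hwz⟩ := exists_le_covBy_of_lt hu'
      obtain rfl := hzr.1 hwz hz
      rcases hw.eq_or_lt with h | h
      · exact h
      · exact absurd (h1 _ h) hu.not_ge
    · have hyr : y ∈ posetIrr T := not_not.1 hyr
      obtain ⟨w, hyw, hw⟩ := exists_covBy_le_of_lt hu
      obtain rfl := hyr.2 hyw hy
      rcases hw.eq_or_lt with h | h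
      · exact h.symm
      · exact absurd (h2 _ h) hu'.not_ge
  · obtain rfl := hy' _ hyx
    obtain rfl := hz' _ hxz
    obtain ⟨l, hl, hul⟩ := exists_isDirectedPath_mem hu.le hu'.le
    rw [hpath l hl] at hul
    simp only [List.mem_cons, List.not_mem_nil, or_false] at hul
    rcases hul with h | h | h
    · exact absurd h hu.ne'
    · exact h
    · exact absurd h hu'.ne

/-- Every element has at least two neighbours in the cover graph. -/
def MinDegreeTwo (T : Type u) [PartialOrder T] : Prop :=
  ∀ u : T, ∃ v w, v ≠ w ∧ (SimpleGraph.hasse T).Adj u v ∧ (SimpleGraph.hasse T).Adj u w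

omit [Finite T] in
theorem MinDegreeTwo.not_isPendant (h : MinDegreeTwo T) (x : T) : ¬ IsPendant x := by
  rintro ⟨y, -, hy⟩
  obtain ⟨v, w, hvw, hv, hw⟩ := h x
  exact hvw ((hy v hv).trans (hy w hw).symm)

omit [Finite T] in
theorem MinDegreeTwo.map {T' : Type v} [PartialOrder T'] (h : MinDegreeTwo T) (e : T ≃o T') :
    MinDegreeTwo T' := by
  intro u
  obtain ⟨v, w, hvw, hv, hw⟩ := h (e.symm u)
  have key : ∀ v, (SimpleGraph.hasse T).Adj (e.symm u) v → (SimpleGraph.hasse T').Adj u (e v) := by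
    intro v hv
    rw [SimpleGraph.hasse_adj] at hv ⊢
    rw [← apply_covBy_apply_iff e, ← apply_covBy_apply_iff e] at hv
    simpa using hv
  exact ⟨e v, e w, by simpa using hvw, key v hv, key w hw⟩

/-- Removing a retractible element preserves the degrees of the other elements. -/
theorem MinDegreeTwo.remove (h : MinDegreeTwo T) {x : T} (hx : IsRetractible x) :
    MinDegreeTwo {u : T // u ≠ x} := by
  obtain ⟨y, z, hy, hz, h1, h2, h3⟩ := hx.exists_covers
  have hcov : ∀ a b : {u : T // u ≠ x}, a.1 ⋖ b.1 → a ⋖ b := fun a b hab =>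
    ⟨hab.1, fun c hac hcb => hab.2 hac hcb⟩
  have hyz : (⟨y, hy.ne⟩ : {u : T // u ≠ x}) ⋖ ⟨z, hz.ne'⟩ :=
    ⟨hy.lt.trans hz.lt, fun c hac hcb => c.2 (h3 c.1 hac hcb)⟩
  have hyz' : ¬ y ⋖ z := fun h => h.2 hy.lt hz.lt
  have huy : ∀ u, u ⋖ x → u = y := fun u hu => by
    by_contra hne
    exact hu.2 (lt_of_le_of_ne (h1 u hu.lt) hne) hy.lt
  have huz : ∀ u, x ⋖ u → u = z := fun u hu => by
    by_contra hne
    exact hu.2 hz.lt (lt_of_le_of_ne (h2 u hu.lt) (Ne.symm hne))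
  intro u
  obtain ⟨v, w, hvw, hv, hw⟩ := h u.1
  have gen : ∀ v, v ≠ x → (SimpleGraph.hasse T).Adj u.1 v →
      ∃ hvx : v ≠ x, (SimpleGraph.hasse {u : T // u ≠ x}).Adj u ⟨v, hvx⟩ := fun v hvx hv =>
    ⟨hvx, hv.imp (hcov _ _) (hcov _ _)⟩
  -- A neighbour of `x` is `y` or `z`. It loses `x` but gains the other one, which is a new
  -- neighbour because `x` separated the two.
  have spec : (SimpleGraph.hasse T).Adj u.1 x → ∃ v', ¬ (SimpleGraph.hasse T).Adj u.1 v'.1 ∧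
      (SimpleGraph.hasse {u : T // u ≠ x}).Adj u v' := by
    rintro (hv | hv)
    · obtain rfl : u = ⟨y, hy.ne⟩ := Subtype.ext (huy _ hv)
      refine ⟨⟨z, hz.ne'⟩, ?_, .inl hyz⟩
      rintro (h | h)
      · exact hyz' h
      · exact absurd (hy.lt.trans hz.lt) h.lt.not_gt
    · obtain rfl : u = ⟨z, hz.ne'⟩ := Subtype.ext (huz _ hv)
      refine ⟨⟨y, hy.ne⟩, ?_, .inr hyz⟩
      rintro (h | h)
      · exact absurd (hy.lt.trans hz.lt) h.lt.not_gt
      · exact hyz' h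
  by_cases hvx : v = x
  · subst hvx
    obtain ⟨v', hv', hv''⟩ := spec hv
    obtain ⟨hwx, hw'⟩ := gen w hvw.symm hw
    exact ⟨v', ⟨w, hwx⟩, fun e => hv' (by rw [e]; exact hw), hv'', hw'⟩
  · obtain ⟨hvx, hv'⟩ := gen v hvx hv
    by_cases hwx : w = x
    · subst hwx
      obtain ⟨w', hw', hw''⟩ := spec hw
      exact ⟨⟨v, hvx⟩, w', fun e => hw' (by rw [← e]; exact hv), hv', hw''⟩
    · obtain ⟨hwx, hw'⟩ := gen w hwx hw
      exact ⟨⟨v, hvx⟩, ⟨w, hwx⟩, fun e => hvw (congrArg Subtype.val e), hv', hw'⟩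

end Paths

/-- Removing an element of a subset amounts to removing it from the corresponding subtype. -/
def diffSingletonOrderIso {P : Type u} [PartialOrder P] (S : Set P) (x : S) :
    {u : S // u ≠ x} ≃o (S \ {(x : P)} : Set P) where
  toFun u := ⟨u.1.1, u.1.2, fun h => u.2 (Subtype.ext h)⟩
  invFun u := ⟨⟨u.1, u.2.1⟩, fun h => u.2.2 (congrArg Subtype.val h)⟩
  left_inv _ := rfl
  right_inv _ := rfl
  map_rel_iff' := Iff.rfl

/-! ### Pulling a labelling back through a retraction. -/

namespace IntervalLabelling

variable {T : Type u} [PartialOrder T] [Finite T] {n : ℕ}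

/-- A labelling of the complement of a retractible element extends to the whole poset. -/
theorem exists_extend {x : T} (hx : IsRetractible x)
    (ℓ : IntervalLabelling {u : T // u ≠ x} n) {P : Finset (Fin n × Fin n)}
    (hℓ : ℓ.LongSupport P) : ∃ ℓ' : IntervalLabelling T n, ℓ'.LongSupport P := by
  classical
  obtain ⟨y, z, hy, hz, h1, h2, h3⟩ := hx.exists_covers
  set y' : {u : T // u ≠ x} := ⟨y, hy.ne⟩ with hy'
  set z' : {u : T // u ≠ x} := ⟨z, hz.ne'⟩ with hz'
  have hyz : y' ⋖ z' := ⟨hy.lt.trans hz.lt, fun c hac hcb => c.2 (h3 c.1 hac hcb)⟩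
  obtain ⟨hcy, hcz⟩ := ℓ.covBy_label hyz
  -- The removed `x` starts where `y` starts and ends where `z` ends. By `covBy_label` this is the
  -- label of `y` or of `z` when one of them is a nonvertex, and a short label when both are
  -- vertices.
  let lo : T → Fin n := fun u => if h : u = x then ℓ.lo y' else ℓ.lo ⟨u, h⟩
  let hi : T → Fin n := fun u => if h : u = x then ℓ.hi z' else ℓ.hi ⟨u, h⟩
  have lox : lo x = ℓ.lo y' := dif_pos rfl
  have hix : hi x = ℓ.hi z' := dif_pos rfl
  have loo : ∀ u (h : u ≠ x), lo u = ℓ.lo ⟨u, h⟩ := fun u h => dif_neg h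
  have hio : ∀ u (h : u ≠ x), hi u = ℓ.hi ⟨u, h⟩ := fun u h => dif_neg h
  -- An element that would share the label of `x` is comparable with both `y'` and `z'`, and `y' ⋖
  -- z'` keeps it from lying strictly between them.
  have key : ∀ u : {u : T // u ≠ x}, ℓ.lo u = ℓ.lo y' → ℓ.hi u = ℓ.hi z' → u ≤ y' ∨ z' ≤ u := by
    intro u hu1 hu2
    have cy : u ≤ y' ∨ y' ≤ u := by
      rcases hcy with e | e
      · exact .inr (ℓ.le_of (by rw [← e, hu1]))
      · exact ℓ.total hu1 (hu2.trans e.symm)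
    have cz : u ≤ z' ∨ z' ≤ u := by
      rcases hcz with e | e
      · exact .inl (ℓ.le_of (by rw [e, hu2]))
      · exact ℓ.total (hu1.trans e) hu2
    rcases cy with cy | cy
    · exact .inl cy
    rcases cz with cz | cz
    · rcases hyz.eq_or_eq cy cz with e | e
      exacts [.inl e.le, .inr e.ge]
    · exact .inr cz
  refine ⟨{
    lo := lo
    hi := hi
    lo_le_hi := ?_
    le_of := ?_
    of_le := ?_
    total := ?_
    vtx := fun i => (ℓ.vtx i).1
    lo_vtx := fun i => by rw [loo _ (ℓ.vtx i).2]; exact ℓ.lo_vtx i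
    hi_vtx := fun i => by rw [hio _ (ℓ.vtx i).2]; exact ℓ.hi_vtx i }, ?_⟩
  · intro u
    by_cases hu : u = x
    · subst hu
      rw [lox, hix]
      exact (ℓ.lo_mono hyz.le).trans (ℓ.lo_le_hi _)
    · rw [loo u hu, hio u hu]
      exact ℓ.lo_le_hi _
  · intro u w h
    by_cases hu : u = x <;> by_cases hw : w = x
    · rw [hu, hw]
    · rw [hu, hix, loo w hw] at h
      rw [hu]
      exact hz.le.trans (ℓ.le_of h)
    · rw [hw, lox, hio u hu] at h
      rw [hw]
      exact le_trans (ℓ.le_of h) hy.le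
    · rw [hio u hu, loo w hw] at h
      exact ℓ.le_of h
  · intro u w h
    by_cases hu : u = x <;> by_cases hw : w = x
    · rw [hu, hw]
      exact .inr ⟨rfl, rfl⟩
    · rw [hu] at h ⊢
      have hzw : z' ≤ ⟨w, hw⟩ := h2 w (lt_of_le_of_ne h (Ne.symm hw))
      rw [hix, lox, loo w hw, hio w hw]
      rcases ℓ.of_le hzw with e | e
      · exact .inl e
      · rcases hcz with e' | e'
        · exact .inl (by rw [← e', e.1])
        · exact .inr ⟨e'.trans e.1, e.2⟩
    · rw [hw] at h ⊢
      have huy : ⟨u, hu⟩ ≤ y' := h1 u (lt_of_le_of_ne h hu)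
      rw [hix, lox, loo u hu, hio u hu]
      rcases ℓ.of_le huy with e | e
      · exact .inl e
      · rcases hcy with e' | e'
        · exact .inl (by rw [e', e.2])
        · exact .inr ⟨e.1, e.2.trans e'⟩
    · rw [hio u hu, loo u hu, loo w hw, hio w hw]
      exact ℓ.of_le (x := ⟨u, hu⟩) (y := ⟨w, hw⟩) h
  · intro u w e1 e2
    by_cases hu : u = x <;> by_cases hw : w = x
    · rw [hu, hw]
      exact .inl le_rfl
    · rw [hu] at e1 e2 ⊢
      rw [lox, loo w hw] at e1
      rw [hix, hio w hw] at e2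
      rcases key _ e1.symm e2.symm with h | h
      · exact .inr (le_trans h hy.le)
      · exact .inl (hz.le.trans h)
    · rw [hw] at e1 e2 ⊢
      rw [lox, loo u hu] at e1
      rw [hix, hio u hu] at e2
      rcases key _ e1 e2 with h | h
      · exact .inl (le_trans h hy.le)
      · exact .inr (hz.le.trans h)
    · rw [loo u hu, loo w hw] at e1
      rw [hio u hu, hio w hw] at e2
      exact ℓ.total e1 e2
  · intro i j
    rw [hℓ i j]
    refine and_congr_right fun hij => ⟨?_, ?_⟩
    · rintro ⟨u, hu⟩
      exact ⟨u.1, (loo u.1 u.2).trans hu.1, (hio u.1 u.2).trans hu.2⟩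
    · rintro ⟨u, hu1 : lo u = i, hu2 : hi u = j⟩
      by_cases hu : u = x
      · rw [hu, lox] at hu1
        rw [hu, hix] at hu2
        rcases hcy with e | e
        · rcases hcz with e' | e'
          -- If `y'` and `z'` were vertices at distance more than one, vertex `i + 1` would break
          -- `y' ⋖ z'`. So `x` opens no new long fibre.
          · exfalso
            let k : Fin n := ⟨i + 1, by omega⟩
            have hk1 : i < k := by simp [k, Fin.lt_def]
            have hk2 : k < j := by simpa [k, Fin.lt_def] using hij
            refine hyz.2 (c := ℓ.vtx k) ?_ ?_
            · rw [ℓ.eq_vtx e, hu1]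
              exact ℓ.vtx_lt_vtx.2 hk1
            · rw [ℓ.eq_vtx e', e', hu2]
              exact ℓ.vtx_lt_vtx.2 hk2
          · exact ⟨z', by rw [← e', hu1], hu2⟩
        · exact ⟨y', hu1, by rw [e, hu2]⟩
      · rw [loo u hu] at hu1
        rw [hio u hu] at hu2
        exact ⟨_, hu1, hu2⟩

end IntervalLabelling

theorem RetractStep.minDegreeTwo {P : Type u} [PartialOrder P] [Finite P] {S T : Set P}
    (h : RetractStep S T) (hS : MinDegreeTwo S) : MinDegreeTwo T := by
  obtain ⟨x, hx, rfl⟩ := h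
  exact (hS.remove hx).map (diffSingletonOrderIso S x)

theorem RetractStep.exists_labelling {P : Type u} [PartialOrder P] [Finite P] {S T : Set P}
    (h : RetractStep S T) {n : ℕ} {Q : Finset (Fin n × Fin n)}
    (hT : ∃ ℓ : IntervalLabelling T n, ℓ.LongSupport Q) :
    ∃ ℓ : IntervalLabelling S n, ℓ.LongSupport Q := by
  obtain ⟨x, hx, rfl⟩ := h
  obtain ⟨ℓ, hℓ⟩ := hT
  exact IntervalLabelling.exists_extend hx (ℓ.map (diffSingletonOrderIso S x)) (hℓ.map _)

/-- If no element is pendant, the basic block is the basic retract, and a labelling of it extends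
to the whole poset. -/
theorem IsBasicBlockOf.exists_labelling {P : Type u} [PartialOrder P] [Finite P] {S : Set P}
    (h : IsBasicBlockOf P S) (hP : MinDegreeTwo P) {n : ℕ} {Q : Finset (Fin n × Fin n)}
    (hS : ∃ ℓ : IntervalLabelling S n, ℓ.LongSupport Q) :
    ∃ ℓ : IntervalLabelling P n, ℓ.LongSupport Q := by
  obtain ⟨R, ⟨hR, -⟩, hRS, -⟩ := h
  have hR2 : MinDegreeTwo R := by
    clear hRS
    induction hR with
    | refl => exact hP.map OrderIso.Set.univ.symm
    | tail _ h ih => exact h.minDegreeTwo ih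
  obtain rfl : R = S := by
    rcases hRS.cases_head with h | ⟨T, ⟨x, hx, -⟩, -⟩
    · exact h
    · exact absurd hx (hR2.not_isPendant x)
  have : ∃ ℓ : IntervalLabelling (Set.univ : Set P) n, ℓ.LongSupport Q := by
    clear hR2 hRS
    induction hR with
    | refl => exact hS
    | tail _ h ih => exact ih (h.exists_labelling hS)
  obtain ⟨ℓ, hℓ⟩ := this
  exact ⟨ℓ.map OrderIso.Set.univ.symm, hℓ.map _⟩

/-- The bottom can only be reducible as a meet, and the two factors lie above distinct atoms. The
top is dual. Any other element has a cover on each side. -/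
theorem IsBlock.minDegreeTwo {L : Type u} [Lattice L] [Finite L] (h : IsBlock L) :
    MinDegreeTwo L := by
  obtain ⟨⟨o, ho, ho'⟩, ⟨e, he, he'⟩⟩ := h
  intro u
  have hne : ∀ x : L, o < x ∨ x = o := fun x => (ho x).lt_or_eq.imp id Eq.symm
  by_cases huo : u = o
  · subst huo
    obtain ⟨y, z, hy, hz, hyz⟩ | ⟨y, z, hy, hz, hyz⟩ := ho'
    · exact absurd (le_antisymm (hyz ▸ le_sup_left) (ho y)) hy
    · obtain ⟨a, ha, hay⟩ := exists_covBy_le_of_lt ((ho y).lt_of_ne hy.symm)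
      obtain ⟨b, hb, hbz⟩ := exists_covBy_le_of_lt ((ho z).lt_of_ne hz.symm)
      refine ⟨a, b, ?_, .inl ha, .inl hb⟩
      rintro rfl
      exact absurd (hyz ▸ le_inf hay hbz) ha.lt.not_ge
  by_cases hue : u = e
  · subst hue
    obtain ⟨y, z, hy, hz, hyz⟩ | ⟨y, z, hy, hz, hyz⟩ := he'
    · obtain ⟨a, hay, ha⟩ := exists_le_covBy_of_lt ((he y).lt_of_ne hy)
      obtain ⟨b, hbz, hb⟩ := exists_le_covBy_of_lt ((he z).lt_of_ne hz)
      refine ⟨a, b, ?_, .inr ha, .inr hb⟩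
      rintro rfl
      exact absurd (hyz ▸ sup_le hay hbz) ha.lt.not_ge
    · exact absurd (le_antisymm (he y) (hyz ▸ inf_le_left)) hy
  obtain ⟨a, -, ha⟩ := exists_le_covBy_of_lt ((ho u).lt_of_ne (Ne.symm huo))
  obtain ⟨b, hb, -⟩ := exists_covBy_le_of_lt ((he u).lt_of_ne hue)
  exact ⟨a, b, (ha.lt.trans hb.lt).ne, .inr ha, .inl hb⟩

namespace IntervalLabelling

/-! ### Lattices with an interval labelling -/

section Lattice

variable {L : Type u} [Lattice L] {n : ℕ} (ℓ : IntervalLabelling L n)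

/-- Two elements strictly below a nonvertex are either comparable or both below the vertex under it,
so their join stays strictly below. -/
theorem eq_of_joinReducible {x : L} (h : JoinReducible x) : ℓ.lo x = ℓ.hi x := by
  by_contra hx
  obtain ⟨y, z, hy, hz, hyz⟩ := h
  have hy' : y < x := lt_of_le_of_ne (hyz ▸ le_sup_left) hy
  have hz' : z < x := lt_of_le_of_ne (hyz ▸ le_sup_right) hz
  rcases ℓ.comparable_or_le_vtx_of_lt hy' hz' with h | h | ⟨h, h'⟩
  · exact hz (by rw [← hyz, sup_eq_right.2 h])
  · exact hy (by rw [← hyz, sup_eq_left.2 h])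
  · exact absurd (hyz.ge.trans (sup_le h h')) (ℓ.vtx_lo_lt hx).not_ge

theorem eq_of_meetReducible {x : L} (h : MeetReducible x) : ℓ.lo x = ℓ.hi x := by
  by_contra hx
  obtain ⟨y, z, hy, hz, hyz⟩ := h
  have hy' : x < y := lt_of_le_of_ne (hyz ▸ inf_le_left) hy.symm
  have hz' : x < z := lt_of_le_of_ne (hyz ▸ inf_le_right) hz.symm
  rcases ℓ.comparable_or_vtx_le_of_gt hy' hz' with h | h | ⟨h, h'⟩
  · exact hy (by rw [← hyz, inf_eq_left.2 h])
  · exact hz (by rw [← hyz, inf_eq_right.2 h])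
  · exact absurd ((le_inf h h').trans hyz.le) (ℓ.lt_vtx_hi hx).not_ge

variable {ℓ} {P : Finset (Fin n × Fin n)} [Finite L]

/-- A vertex is the meet of two distinct upper covers or the join of two distinct lower covers.
`Spanning` provides one such pair at every vertex. -/
theorem redSet_eq (h : ℓ.LongSupport P) (hP : Spanning P) : redSet L = Set.range ℓ.vtx := by
  ext x
  constructor
  · intro hx
    exact ℓ.lo_eq_hi_iff.1 (hx.elim ℓ.eq_of_joinReducible ℓ.eq_of_meetReducible)
  · rintro ⟨i, rfl⟩
    obtain ⟨⟨a, b⟩, hp, rfl | rfl⟩ := hP i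
    · obtain ⟨y, z, hyz, hy, hz⟩ := exists_upper_covers h hp
      refine .inr ⟨y, z, hy.lt.ne', hz.lt.ne', ?_⟩
      by_contra hne
      have hlt := lt_of_le_of_ne (le_inf hy.le hz.le) (Ne.symm hne)
      have e1 := (hy.eq_or_eq hlt.le inf_le_left).resolve_left hlt.ne'
      have e2 := (hz.eq_or_eq hlt.le inf_le_right).resolve_left hlt.ne'
      exact hyz (e1.symm.trans e2)
    · obtain ⟨y, z, hyz, hy, hz⟩ := exists_lower_covers h hp
      refine .inl ⟨y, z, hy.lt.ne, hz.lt.ne, ?_⟩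
      by_contra hne
      have hlt := lt_of_le_of_ne (sup_le hy.le hz.le) hne
      have e1 := (hy.eq_or_eq le_sup_left hlt.le).resolve_right hlt.ne
      have e2 := (hz.eq_or_eq le_sup_right hlt.le).resolve_right hlt.ne
      exact hyz (e1.symm.trans e2)

end Lattice

/-! ### The nullity -/

section Nullity

variable {T : Type u} [PartialOrder T] {n : ℕ} {ℓ : IntervalLabelling T n}

theorem card_edgeSet_hasse (T : Type u) [PartialOrder T] :
    Nat.card (SimpleGraph.hasse T).edgeSet = Nat.card {p : T × T // p.1 ⋖ p.2} := by
  symm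
  refine Nat.card_eq_of_bijective (fun p => ⟨s(p.1.1, p.1.2), .inl p.2⟩) ⟨?_, ?_⟩
  · rintro ⟨⟨a, b⟩, h⟩ ⟨⟨c, d⟩, h'⟩ e
    have e := congrArg Subtype.val e
    simp only [Sym2.eq_iff] at e
    rcases e with ⟨rfl, rfl⟩ | ⟨rfl, rfl⟩
    · rfl
    · exact absurd h.lt h'.lt.not_gt
  · rintro ⟨e, he⟩
    induction e using Sym2.ind with
    | _ a b =>
      rcases he with h | h
      · exact ⟨⟨(a, b), h⟩, rfl⟩
      · exact ⟨⟨(b, a), h⟩, Subtype.ext Sym2.eq_swap⟩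

variable [Finite T]

/-- In a vertex `vtx j`, there is one lower cover for each pair `(i, j)` that is short or in `P`. -/
theorem exists_covBy_vtx {P : Finset (Fin n × Fin n)} (h : ℓ.LongSupport P) {i j : Fin n}
    (hij : (i : ℕ) + 1 = j ∨ (i, j) ∈ P) : ∃ y, y ⋖ ℓ.vtx j ∧ ℓ.lo y = i := by
  rcases hij with hij | hij
  · have hlt : i < j := by rw [Fin.lt_def]; omega
    obtain ⟨y, hy, hyj⟩ := exists_le_covBy_of_lt (ℓ.vtx_lt_vtx.2 hlt)
    refine ⟨y, hyj, ?_⟩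
    have h1 := ℓ.vtx_le_iff.1 hy
    have h2 : ¬ j ≤ ℓ.lo y := fun h => (ℓ.vtx_le_iff.2 h).not_gt hyj.lt
    rw [Fin.le_def] at h1 h2
    exact Fin.ext (by omega)
  · obtain ⟨hij, x, rfl, rfl⟩ := (h _ _).1 hij
    have hx : ℓ.lo x ≠ ℓ.hi x := fun e => by rw [e] at hij; omega
    obtain ⟨y, hxy, hy⟩ := exists_le_covBy_of_lt (ℓ.lt_vtx_hi hx)
    refine ⟨y, hy, ?_⟩
    rcases ℓ.vtx_hi_le_or hxy with e | e
    · exact absurd e hy.lt.not_ge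
    · exact e.1.symm

/-- Coverings are sorted by their upper end. A nonvertex has exactly one lower cover; the vertex `j`
has exactly one for each pair `(i, j)` in `E`, namely the top of that fibre, or `vtx i` when a short
fibre is empty. -/
theorem card_covBy {P E : Finset (Fin n × Fin n)} (h : ℓ.LongSupport P)
    (hE : ∀ i j : Fin n, (i, j) ∈ E ↔ (i : ℕ) + 1 = j ∨ (i, j) ∈ P) :
    Nat.card {p : T × T // p.1 ⋖ p.2} = Nat.card {x : T // ℓ.lo x ≠ ℓ.hi x} + E.card := by
  classical
  have hlab : ∀ y z : T, y ⋖ z → ℓ.lo z = ℓ.hi z → (ℓ.lo y, ℓ.lo z) ∈ E := by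
    intro y z hyz hz
    rw [hE]
    rcases (ℓ.covBy_label hyz).1 with e | e
    · left
      have hlt : ℓ.lo y < ℓ.lo z := by
        rw [← ℓ.vtx_lt_vtx, ← ℓ.eq_vtx e, ← ℓ.eq_vtx hz]
        exact hyz.lt
      by_contra hne
      rw [Fin.lt_def] at hlt
      let k : Fin n := ⟨ℓ.lo y + 1, by omega⟩
      have hk1 : ℓ.lo y < k := by simp [k, Fin.lt_def]
      have hk2 : k < ℓ.lo z := by simp only [k, Fin.lt_def]; omega
      refine hyz.2 (c := ℓ.vtx k) ?_ ?_
      · rw [ℓ.eq_vtx e]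
        exact ℓ.vtx_lt_vtx.2 hk1
      · rw [ℓ.eq_vtx hz]
        exact ℓ.vtx_lt_vtx.2 hk2
    · by_cases hlt : (ℓ.lo y : ℕ) + 1 = ℓ.lo z
      · exact .inl hlt
      · right
        rw [h]
        refine ⟨?_, y, rfl, e.trans hz.symm⟩
        have h1 : ℓ.lo y ≤ ℓ.lo z := ℓ.lo_mono hyz.le
        have h2 : ℓ.lo y ≠ ℓ.lo z := fun h2 => hyz.lt.ne <| by
          rw [ℓ.eq_vtx hz, ← h2]
          exact ℓ.eq_vtx (h2.trans (hz.trans e.symm))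
        rw [Fin.le_def] at h1
        rw [Ne, Fin.ext_iff] at h2
        omega
  let f : {p : T × T // p.1 ⋖ p.2} → {x : T // ℓ.lo x ≠ ℓ.hi x} ⊕ E := fun p =>
    if hz : ℓ.lo p.1.2 = ℓ.hi p.1.2 then .inr ⟨_, hlab _ _ p.2 hz⟩ else .inl ⟨p.1.2, hz⟩
  have hf : Function.Bijective f := by
    constructor
    · rintro ⟨⟨y, z⟩, hyz : y ⋖ z⟩ ⟨⟨y', z'⟩, hyz' : y' ⋖ z'⟩ e
      by_cases hz : ℓ.lo z = ℓ.hi z <;> by_cases hz' : ℓ.lo z' = ℓ.hi z' <;>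
        simp only [f, hz, hz', dite_true, dite_false, Sum.inr.injEq, Sum.inl.injEq, Subtype.mk.injEq,
          Prod.mk.injEq, reduceCtorEq] at e
      · obtain rfl : z = z' := by rw [ℓ.eq_vtx hz, ℓ.eq_vtx hz', hz, hz', e.2]
        -- Two lower covers of the same vertex that start at the same place are comparable: one of
        -- them is the vertex there, or both lie in one fibre.
        have hc : y ≤ y' ∨ y' ≤ y := by
          rcases (ℓ.covBy_label hyz).1 with h1 | h1
          · exact .inl (by rw [ℓ.eq_vtx h1]; exact ℓ.vtx_le_iff.2 e.1.le)
          · rcases (ℓ.covBy_label hyz').1 with h2 | h2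
            · exact .inr (by rw [ℓ.eq_vtx h2]; exact ℓ.vtx_le_iff.2 e.1.ge)
            · exact ℓ.total e.1 (h1.trans h2.symm)
        obtain rfl : y = y' := by
          rcases hc with hc | hc
          · exact ((hyz.eq_or_eq hc hyz'.le).resolve_right hyz'.ne).symm
          · exact (hyz'.eq_or_eq hc hyz.le).resolve_right hyz.ne
        rfl
      · subst e
        obtain rfl := ℓ.covBy_left_unique hz hyz hyz'
        rfl
    · rintro (⟨x, hx⟩ | ⟨⟨i, j⟩, hij⟩)
      · obtain ⟨y, -, hy⟩ := exists_le_covBy_of_lt (ℓ.vtx_lo_lt hx)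
        exact ⟨⟨(y, x), hy⟩, by simp [f, hx]⟩
      · obtain ⟨y, hy, rfl⟩ := exists_covBy_vtx h ((hE i j).1 hij)
        exact ⟨⟨(y, ℓ.vtx j), hy⟩, by simp [f]⟩
  rw [Nat.card_eq_of_bijective f hf, Nat.card_sum, Nat.card_eq_fintype_card (α := E),
    Fintype.card_coe]

theorem card_eq : Nat.card T = n + Nat.card {x : T // ℓ.lo x ≠ ℓ.hi x} := by
  classical
  rw [Nat.card_congr (Equiv.sumCompl fun x => ℓ.lo x = ℓ.hi x).symm, Nat.card_sum]
  congr 1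
  refine Eq.trans (Eq.symm ?_) (Nat.card_fin n)
  refine Nat.card_eq_of_bijective (fun i => ⟨ℓ.vtx i, by simp⟩) ⟨?_, ?_⟩
  · intro i j h
    exact ℓ.vtx_injective (congrArg Subtype.val h)
  · rintro ⟨x, hx⟩
    exact ⟨ℓ.lo x, Subtype.ext (ℓ.eq_vtx hx).symm⟩

theorem card_connectedComponent (hn : 0 < n) (ℓ : IntervalLabelling T n) :
    Nat.card (SimpleGraph.hasse T).ConnectedComponent = 1 := by
  have hreach : ∀ x, (SimpleGraph.hasse T).Reachable (ℓ.vtx ⟨0, hn⟩) x := by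
    intro x
    have := reflTransGen_covBy_of_le (ℓ.vtx_le_iff.2 (Fin.le_def.2 (Nat.zero_le _)) :
      ℓ.vtx ⟨0, hn⟩ ≤ x)
    induction this with
    | refl => exact .rfl
    | tail _ h ih => exact ih.trans (SimpleGraph.Adj.reachable (.inl h))
  rw [Nat.card_eq_one_iff_unique]
  refine ⟨⟨fun a b => ?_⟩, ⟨(SimpleGraph.hasse T).connectedComponentMk (ℓ.vtx ⟨0, hn⟩)⟩⟩
  induction a using SimpleGraph.ConnectedComponent.ind
  induction b using SimpleGraph.ConnectedComponent.ind
  exact SimpleGraph.ConnectedComponent.eq.2 ((hreach _).symm.trans (hreach _))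

/-- The nonvertices contribute equally to edges and to elements, so they cancel. The poset is
connected because everything lies above the lowest vertex. -/
theorem posetNullity_eq (hn : 0 < n) {P E : Finset (Fin n × Fin n)} (h : ℓ.LongSupport P)
    (hE : ∀ i j : Fin n, (i, j) ∈ E ↔ (i : ℕ) + 1 = j ∨ (i, j) ∈ P) :
    posetNullity T = E.card - n + 1 := by
  rw [posetNullity, card_edgeSet_hasse, card_covBy h hE, card_connectedComponent hn ℓ,
    card_eq (ℓ := ℓ)]
  push_cast
  ring

end Nullity

theorem isMaximalBlock {L : Type u} [Lattice L] [Finite L] {n : ℕ} (hn : 0 < n)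
    {ℓ : IntervalLabelling L n} {P E : Finset (Fin n × Fin n)} (h : ℓ.LongSupport P)
    (hP : Spanning P) (hE : ∀ i j : Fin n, (i, j) ∈ E ↔ (i : ℕ) + 1 = j ∨ (i, j) ∈ P)
    {k : ℕ} (hk : E.card + 1 = k + n) : IsMaximalBlock L (Nat.card L) n k := by
  have hmem : ∀ i, ℓ.vtx i ∈ redSet L := fun i => by rw [redSet_eq h hP]; exact ⟨i, rfl⟩
  have : Nonempty L := ⟨ℓ.vtx ⟨0, hn⟩⟩
  refine ⟨Nat.card_pos, rfl, ⟨⟨ℓ.vtx ⟨0, hn⟩, fun x => ?_, hmem _⟩,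
    ⟨ℓ.vtx ⟨n - 1, by omega⟩, fun x => ?_, hmem _⟩⟩, ?_, ?_, ?_⟩
  · exact ℓ.vtx_le_iff.2 (Fin.le_def.2 (Nat.zero_le _))
  · exact ℓ.le_vtx_iff.2 (Fin.le_def.2 (by simp only; omega))
  · rw [redSet_eq h hP]
    rintro _ ⟨i, rfl⟩ _ ⟨j, rfl⟩ -
    simpa [ℓ.vtx_le_vtx] using le_total i j
  · rw [redSet_eq h hP, ← Set.image_univ, Set.ncard_image_of_injective _ ℓ.vtx_injective,
      Set.ncard_univ, Nat.card_fin]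
  · rw [posetNullity_eq hn h hE]
    omega

/-! ### The basic block -/

section BasicBlock

variable {T : Type u} [PartialOrder T] {n : ℕ}

/-- The restriction of a labelling to the complement of an element that is not a vertex. -/
def remove (ℓ : IntervalLabelling T n) (x : T) (hx : ℓ.lo x ≠ ℓ.hi x) :
    IntervalLabelling {u : T // u ≠ x} n where
  lo u := ℓ.lo u
  hi u := ℓ.hi u
  lo_le_hi u := ℓ.lo_le_hi u
  le_of h := ℓ.le_of h
  of_le h := ℓ.of_le (Subtype.coe_le_coe.2 h)
  total h h' := ℓ.total h h'
  vtx i := ⟨ℓ.vtx i, fun h => hx (by rw [← h]; simp)⟩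
  lo_vtx i := by simp
  hi_vtx i := by simp

variable {ℓ : IntervalLabelling T n} {P : Finset (Fin n × Fin n)}

theorem LongSupport.remove (h : ℓ.LongSupport P) {x : T} (hx : ℓ.lo x ≠ ℓ.hi x)
    (hx' : (ℓ.lo x : ℕ) + 1 < ℓ.hi x → ∃ y, y ≠ x ∧ ℓ.lo y = ℓ.lo x ∧ ℓ.hi y = ℓ.hi x) :
    (ℓ.remove x hx).LongSupport P := by
  intro i j
  rw [h i j]
  refine and_congr_right fun hij => ⟨?_, ?_⟩
  · rintro ⟨y, rfl, rfl⟩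
    by_cases hy : y = x
    · subst hy
      obtain ⟨z, hz, hz'⟩ := hx' hij
      exact ⟨⟨z, hz⟩, hz'⟩
    · exact ⟨⟨y, hy⟩, rfl, rfl⟩
  · rintro ⟨y, hy⟩
    exact ⟨y.1, hy⟩

variable [Finite T]

theorem minDegreeTwo (h : ℓ.LongSupport P) (hP : Spanning P) : MinDegreeTwo T := by
  intro u
  by_cases hu : ℓ.lo u = ℓ.hi u
  · rw [ℓ.eq_vtx hu]
    obtain ⟨⟨a, b⟩, hp, e | e⟩ := hP (ℓ.lo u)
    · rw [← e]
      obtain ⟨y, z, hyz, hy, hz⟩ := exists_upper_covers h hp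
      exact ⟨y, z, hyz, .inl hy, .inl hz⟩
    · rw [← e]
      obtain ⟨y, z, hyz, hy, hz⟩ := exists_lower_covers h hp
      exact ⟨y, z, hyz, .inr hy, .inr hz⟩
  · obtain ⟨⟨y, hy, -⟩, ⟨z, hz, -⟩⟩ := ℓ.mem_posetIrrStar hu
    exact ⟨y, z, (hy.lt.trans hz.lt).ne, .inr hy, .inl hz⟩

/-- In a fibre with at least two elements, every element is retractible. -/
theorem isRetractible_of_fibre (h : ℓ.LongSupport P) (hP : Spanning P) {x x' : T} (hne : x ≠ x')
    (hlo : ℓ.lo x = ℓ.lo x') (hhi : ℓ.hi x = ℓ.hi x') :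
    ℓ.lo x ≠ ℓ.hi x ∧ IsRetractible x := by
  have hx : ℓ.lo x ≠ ℓ.hi x := fun e => hne <| by
    rw [ℓ.eq_vtx e, ℓ.eq_vtx (hlo.symm.trans (e.trans hhi)), hlo]
  refine ⟨hx, ℓ.mem_posetIrrStar hx, .inl ?_⟩
  rintro ⟨y, hy, z, hz, hyx, hxz⟩
  rw [mem_posetRed_iff h hP] at hy hz
  have hy' := ((ℓ.covBy_label hyx).2).resolve_left hx
  have hz' := ((ℓ.covBy_label hxz).1).resolve_left hx
  -- Reducible covers `y`, `z` of `x` would be the vertices bounding the whole fibre. Then `x'` lies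
  -- between them and is comparable with `x`, so a covering would make it equal to `x`, `y` or `z`.
  have h1 : y ≤ x' := by rw [ℓ.eq_vtx hy]; exact ℓ.vtx_le_iff.2 (hy'.trans hlo).le
  have h2 : x' ≤ z := by rw [ℓ.eq_vtx hz, hz]; exact ℓ.le_vtx_iff.2 (hhi.symm.trans hz').le
  have hx'v : ℓ.lo x' ≠ ℓ.hi x' := by rwa [← hlo, ← hhi]
  rcases ℓ.total hlo hhi with h | h
  · rcases hxz.eq_or_eq h h2 with e | e
    · exact hne e.symm
    · exact hx'v (by rw [e]; exact hz)
  · rcases hyx.eq_or_eq h1 h with e | e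
    · exact hx'v (by rw [e]; exact hy)
    · exact hne e.symm

/-- The only element of a fibre over a pair `(i, i + 1)` is retractible. -/
theorem isRetractible_of_short (h : ℓ.LongSupport P) (hP : Spanning P) {x : T}
    (hx : (ℓ.lo x : ℕ) + 1 = ℓ.hi x)
    (huniq : ∀ x', ℓ.lo x' = ℓ.lo x → ℓ.hi x' = ℓ.hi x → x' = x) : IsRetractible x := by
  have hne : ℓ.lo x ≠ ℓ.hi x := fun e => by rw [e] at hx; omega
  -- Strictly between consecutive vertices `i` and `i + 1` the only possible label is `(i, i + 1)`,
  -- whose fibre is `{x}`.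
  have hbetween : ∀ u, ℓ.vtx (ℓ.lo x) < u → u < ℓ.vtx (ℓ.hi x) → u = x := by
    intro u hu hu'
    have h1 := ℓ.vtx_le_iff.1 hu.le
    have h2 := ℓ.le_vtx_iff.1 hu'.le
    have h3 := ℓ.lo_le_hi u
    have h4 : ¬ ℓ.hi x ≤ ℓ.lo u := fun e => (ℓ.vtx_le_iff.2 e).not_gt hu'
    have h5 : ¬ ℓ.hi u ≤ ℓ.lo x := fun e => (ℓ.le_vtx_iff.2 e).not_gt hu
    rw [Fin.le_def] at h1 h2 h3 h4 h5
    exact huniq u (Fin.ext (by omega)) (Fin.ext (by omega))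
  have hyx : ℓ.vtx (ℓ.lo x) ⋖ x := ⟨ℓ.vtx_lo_lt hne, fun c hc hc' => hc'.ne
    (hbetween c hc (hc'.trans (ℓ.lt_vtx_hi hne)))⟩
  have hxz : x ⋖ ℓ.vtx (ℓ.hi x) := ⟨ℓ.lt_vtx_hi hne, fun c hc hc' => hc.ne'
    (hbetween c ((ℓ.vtx_lo_lt hne).trans hc) hc')⟩
  refine ⟨ℓ.mem_posetIrrStar hne, .inr ⟨_, vtx_mem_posetRed h hP _, _, vtx_mem_posetRed h hP _,
    hyx, hxz, ?_⟩⟩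
  -- In a directed path the second vertex lies below the last one. Applied at successive positions,
  -- this leaves only the path through `x`.
  have hlast : ∀ (l : List T) (u w z : T), (u :: w :: l).IsChain (· ⋖ ·) →
      (u :: w :: l).getLast? = some z → w ≤ z := by
    intro l
    induction l with
    | nil =>
      intro u w z _ hz
      simp only [List.getLast?_cons_cons, List.getLast?_singleton, Option.some.injEq] at hz
      exact hz.le
    | cons a l ih =>
      intro u w z hl hz
      rw [List.isChain_cons_cons] at hl
      rw [List.getLast?_cons_cons] at hz
      exact (List.isChain_cons_cons.1 hl.2).1.le.trans (ih w a z hl.2 hz)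
  rintro l ⟨hl, hy, hz⟩
  rcases l with - | ⟨u, l⟩
  · simp at hy
  simp only [List.head?_cons, Option.some.injEq] at hy
  subst hy
  rcases l with - | ⟨w, l⟩
  · simp only [List.getLast?_singleton, Option.some.injEq] at hz
    exact absurd hz (hyx.lt.trans hxz.lt).ne
  have h1 := hlast _ _ _ _ hl hz
  rw [List.isChain_cons_cons] at hl
  obtain rfl : w = x := by
    refine hbetween w hl.1.lt (lt_of_le_of_ne h1 ?_)
    rintro rfl
    exact hl.1.2 hyx.lt hxz.lt
  rw [List.getLast?_cons_cons] at hz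
  rcases l with - | ⟨a, l⟩
  · simp only [List.getLast?_singleton, Option.some.injEq] at hz
    exact absurd hz hxz.lt.ne
  have h2 := hlast _ _ _ _ hl.2 hz
  obtain ⟨h3, h4⟩ := List.isChain_cons_cons.1 hl.2
  obtain rfl := (hxz.eq_or_eq h3.le h2).resolve_left h3.lt.ne'
  rw [List.getLast?_cons_cons] at hz
  rcases l with - | ⟨b, l⟩
  · rfl
  · have h5 := hlast _ _ _ _ h4 hz
    exact absurd h5 (List.isChain_cons_cons.1 h4).1.lt.not_ge

/-- A labelled poset is basic, or an element can be retracted without changing the support. -/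
theorem basic_or_exists (h : ℓ.LongSupport P) (hP : Spanning P) :
    ℓ.Basic ∨ ∃ (x : T) (hx : ℓ.lo x ≠ ℓ.hi x), IsRetractible x ∧
      (ℓ.remove x hx).LongSupport P := by
  by_cases hb : ∀ x y, ℓ.lo x = ℓ.lo y → ℓ.hi x = ℓ.hi y → x = y
  · by_cases hs : ∀ x, (ℓ.lo x : ℕ) + 1 ≠ ℓ.hi x
    · exact .inl ⟨hb, hs⟩
    · push Not at hs
      obtain ⟨x, hx⟩ := hs
      have hne : ℓ.lo x ≠ ℓ.hi x := fun e => by rw [e] at hx; omega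
      exact .inr ⟨x, hne, isRetractible_of_short h hP hx fun x' h1 h2 => hb _ _ h1 h2,
        h.remove hne fun h' => by omega⟩
  · push Not at hb
    obtain ⟨x, y, h1, h2, hxy⟩ := hb
    obtain ⟨hne, hx⟩ := isRetractible_of_fibre h hP hxy h1 h2
    exact .inr ⟨x, hne, hx, h.remove hne fun _ => ⟨y, hxy.symm, h1.symm, h2.symm⟩⟩

/-- The covers of a nonvertex in a basic labelling are vertices, hence reducible, which excludes the
first clause of retractibility. Its label is long, so a path through vertex `lo x + 1` avoids `x`,
which excludes the second. -/
theorem Basic.not_isRetractible (hb : ℓ.Basic) (h : ℓ.LongSupport P) (hP : Spanning P) (x : T) :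
    ¬ IsRetractible x := by
  rintro ⟨⟨⟨y, hy, hy'⟩, ⟨z, hz, hz'⟩⟩, hx⟩
  have hne : ℓ.lo x ≠ ℓ.hi x := fun e => by
    exact (mem_posetRed_iff h hP).2 e ⟨fun a ha b hb => (hy' a ha).trans (hy' b hb).symm,
      fun a ha b hb => (hz' a ha).trans (hz' b hb).symm⟩
  have hlt : (ℓ.lo x : ℕ) + 1 < ℓ.hi x := by
    have h1 := hb.2 x
    have h2 := ℓ.lo_le_hi x
    omega
  have hyv : ℓ.lo y = ℓ.hi y := by
    rcases (ℓ.covBy_label hy).1 with e | e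
    · exact e
    · rw [hb.1 y x (((ℓ.covBy_label hy).2).resolve_left hne) e] at hy
      exact absurd rfl hy.ne
  have hzv : ℓ.lo z = ℓ.hi z := by
    rcases (ℓ.covBy_label hz).2 with e | e
    · exact e
    · rw [hb.1 x z e (((ℓ.covBy_label hz).1).resolve_left hne)] at hz
      exact absurd rfl hz.ne
  have hyx := ((ℓ.covBy_label hy).2).resolve_left hne
  have hzx := ((ℓ.covBy_label hz).1).resolve_left hne
  rcases hx with hx | ⟨y₁, -, z₁, -, hy₁, hz₁, hpath⟩
  · exact hx ⟨y, (mem_posetRed_iff h hP).2 hyv, z, (mem_posetRed_iff h hP).2 hzv, hy, hz⟩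
  · obtain rfl := hy' _ hy₁
    obtain rfl := hz' _ hz₁
    let k : Fin n := ⟨ℓ.lo x + 1, by omega⟩
    have hk1 : ℓ.lo y₁ < k := by simp [k, hyx, Fin.lt_def]
    have hk2 : k < ℓ.lo z₁ := by simpa [k, hzv, ← hzx, Fin.lt_def] using hlt
    have h1 : y₁ < ℓ.vtx k := by rw [ℓ.eq_vtx hyv]; exact ℓ.vtx_lt_vtx.2 hk1
    have h2 : ℓ.vtx k < z₁ := by rw [ℓ.eq_vtx hzv]; exact ℓ.vtx_lt_vtx.2 hk2
    obtain ⟨l, hl, hkl⟩ := exists_isDirectedPath_mem h1.le h2.le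
    rw [hpath l hl] at hkl
    simp only [List.mem_cons, List.not_mem_nil, or_false] at hkl
    rcases hkl with e | e | e
    · exact h1.ne' e
    · exact hne (by rw [← e]; simp)
    · exact h2.ne e

/-- Successive retraction leads to a basic labelled subposet with the same long support. -/
theorem exists_retract {Q : Type u} [PartialOrder Q] [Finite Q] (hP : Spanning P) (S : Set Q)
    (ℓ : IntervalLabelling S n) (h : ℓ.LongSupport P) :
    ∃ S' : Set Q, Relation.ReflTransGen RetractStep S S' ∧
      ∃ ℓ' : IntervalLabelling S' n, ℓ'.LongSupport P ∧ ℓ'.Basic := by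
  induction hc : S.ncard using Nat.strong_induction_on generalizing S with
  | _ m ih =>
    rcases basic_or_exists h hP with hb | ⟨x, hx, hret, hrem⟩
    · exact ⟨S, .refl, ℓ, h, hb⟩
    · have hlt : (S \ {(x : Q)}).ncard < m := by
        rw [← hc]
        exact Set.ncard_sdiff_singleton_lt_of_mem x.2 (Set.toFinite S)
      obtain ⟨S', hS', hℓ'⟩ := ih _ hlt (S \ {(x : Q)})
        ((ℓ.remove x hx).map (diffSingletonOrderIso S x).symm) (hrem.map _) rfl
      exact ⟨S', .head ⟨x, hret, rfl⟩ hS', hℓ'⟩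

/-- The retract is again labelled with spanning support, so all degrees are at least two and no
pendant vertex has to be removed. -/
theorem exists_isBasicBlockOf (h : ℓ.LongSupport P) (hP : Spanning P) :
    ∃ S : Set T, IsBasicBlockOf T S ∧ ∃ ℓ' : IntervalLabelling S n, ℓ'.LongSupport P ∧
      ℓ'.Basic := by
  obtain ⟨S, hS, ℓ', hℓ', hb⟩ :=
    exists_retract hP Set.univ (ℓ.map OrderIso.Set.univ) (h.map _)
  exact ⟨S, ⟨S, ⟨hS, hb.not_isRetractible hℓ' hP⟩, .refl,
    (minDegreeTwo hℓ' hP).not_isPendant⟩, ℓ', hℓ', hb⟩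

omit [Finite T] in
/-- The height of a basic labelled poset. -/
theorem Basic.krullDim_eq {n : ℕ} {ℓ : IntervalLabelling T (n + 1)} (hb : ℓ.Basic) :
    Order.krullDim T = n := by
  apply le_antisymm
  -- A rank function with values in `0, …, n`: a nonvertex has a long label, so the value `lo x + 1`
  -- is strictly below `hi x`. The chain of vertices attains the bound.
  · let f : T → ℕ := fun x => if ℓ.lo x = ℓ.hi x then ℓ.lo x else ℓ.lo x + 1
    have hf : StrictMono f := by
      intro x y hxy
      rcases ℓ.of_le hxy.le with h | h
      · have h1 := hb.2 x
        have h2 := ℓ.lo_le_hi x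
        have h3 : ℓ.lo x = ℓ.hi x → ℓ.lo y = ℓ.hi y → (ℓ.lo x : ℕ) ≠ ℓ.lo y := by
          intro hx hy e
          exact hxy.ne (by rw [ℓ.eq_vtx hx, ℓ.eq_vtx hy, Fin.ext e])
        rw [Fin.le_def] at h h2
        simp only [f]
        split_ifs with hx hy hy
        · have := h3 hx hy
          rw [← hx] at h
          omega
        · rw [← hx] at h
          omega
        all_goals
          rw [Fin.ext_iff] at hx
          omega
      · exact absurd (hb.1 x y h.1 h.2) hxy.ne
    have hfn : ∀ x, f x ≤ n := by
      intro x
      have h2 := ℓ.lo_le_hi x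
      rw [Fin.le_def] at h2
      simp only [f]
      split_ifs with hx
      · omega
      · rw [Fin.ext_iff] at hx
        omega
    refine iSup_le fun p => ?_
    have hinj : Function.Injective fun i : Fin (p.length + 1) =>
        (⟨f (p i), Nat.lt_succ_of_le (hfn _)⟩ : Fin (n + 1)) := by
      intro i j hij
      exact (hf.comp p.strictMono).injective (Fin.ext_iff.1 hij)
    have := Fintype.card_le_of_injective _ hinj
    simp only [Fintype.card_fin, Nat.add_le_add_iff_right] at this
    exact_mod_cast this
  · let p : LTSeries T := ⟨n, ℓ.vtx, fun i => ℓ.vtx_lt_vtx.2 (Fin.castSucc_lt_succ)⟩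
    exact le_iSup (fun p : LTSeries T => (p.length : WithBot ℕ∞)) p

end BasicBlock

end IntervalLabelling

namespace IntervalLabelling

/-! ### Adjuncts of three singletons to a chain -/

/-- The labelling of the adjunct of three singletons to the chain `Fin 5`. -/
def tripleAdjunct (a₁ b₁ a₂ b₂ a₃ b₃ : Fin 5) (h₁ : a₁ < b₁) (h₂ : a₂ < b₂) (h₃ : a₃ < b₃)
    (h₁₂ : (a₁, b₁) ≠ (a₂, b₂)) (h₁₃ : (a₁, b₁) ≠ (a₃, b₃)) (h₂₃ : (a₂, b₂) ≠ (a₃, b₃)) :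
    IntervalLabelling (TripleAdjunct a₁ b₁ a₂ b₂ a₃ b₃) 5 where
  lo
    | Sum.inl (Sum.inl (Sum.inl i)) => i
    | Sum.inl (Sum.inl (Sum.inr _)) => a₁
    | Sum.inl (Sum.inr _) => a₂
    | Sum.inr _ => a₃
  hi
    | Sum.inl (Sum.inl (Sum.inl i)) => i
    | Sum.inl (Sum.inl (Sum.inr _)) => b₁
    | Sum.inl (Sum.inr _) => b₂
    | Sum.inr _ => b₃
  lo_le_hi := by
    rintro (((x | x) | x) | x)
    exacts [le_rfl, h₁.le, h₂.le, h₃.le]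
  le_of := by
    rintro (((x | x) | x) | x) (((y | y) | y) | y) h
    -- The adjunct order unfolds to `hi x ≤ lo y`, except inside a single added point, where the
    -- hypothesis would read `b ≤ a`.
    all_goals first
      | exact h
      | exact absurd h (by first | exact h₁.not_ge | exact h₂.not_ge | exact h₃.not_ge)
  of_le := by
    rintro (((x | x) | x) | x) (((y | y) | y) | y) h
    all_goals first
      | exact .inl h
      | exact .inr ⟨rfl, rfl⟩
  total := by
    have r : ∀ x y : Fin 1, x ≤ y := fun x y => (Subsingleton.elim x y).le
    rintro (((x | x) | x) | x) (((y | y) | y) | y) e e'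
    all_goals dsimp only at e e'
    all_goals first
      | exact .inl (r x y)
      | exact .inl (le_of_eq e)
      | exact (h₁₂ (Prod.ext e e')).elim
      | exact (h₁₂ (Prod.ext e.symm e'.symm)).elim
      | exact (h₁₃ (Prod.ext e e')).elim
      | exact (h₁₃ (Prod.ext e.symm e'.symm)).elim
      | exact (h₂₃ (Prod.ext e e')).elim
      | exact (h₂₃ (Prod.ext e.symm e'.symm)).elim
      | exact absurd (e.symm.trans e') h₁.ne
      | exact absurd (e.symm.trans e') h₂.ne
      | exact absurd (e.symm.trans e') h₃.ne
      | exact absurd (e.trans e'.symm) h₁.ne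
      | exact absurd (e.trans e'.symm) h₂.ne
      | exact absurd (e.trans e'.symm) h₃.ne
  vtx i := Sum.inl (Sum.inl (Sum.inl i))
  lo_vtx _ := rfl
  hi_vtx _ := rfl

section TripleAdjunct

variable {a₁ b₁ a₂ b₂ a₃ b₃ : Fin 5} {h₁ : a₁ < b₁} {h₂ : a₂ < b₂} {h₃ : a₃ < b₃}
  {h₁₂ : (a₁, b₁) ≠ (a₂, b₂)} {h₁₃ : (a₁, b₁) ≠ (a₃, b₃)} {h₂₃ : (a₂, b₂) ≠ (a₃, b₃)}

theorem tripleAdjunct_basic (g₁ : (a₁ : ℕ) + 1 < b₁) (g₂ : (a₂ : ℕ) + 1 < b₂)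
    (g₃ : (a₃ : ℕ) + 1 < b₃) :
    (tripleAdjunct a₁ b₁ a₂ b₂ a₃ b₃ h₁ h₂ h₃ h₁₂ h₁₃ h₂₃).Basic := by
  constructor
  · rintro (((x | x) | x) | x) (((y | y) | y) | y) e e'
    all_goals dsimp only [tripleAdjunct] at e e'
    all_goals first
      | exact congrArg (fun x : Fin 1 => (Sum.inr x : TripleAdjunct a₁ b₁ a₂ b₂ a₃ b₃))
          (Subsingleton.elim x y)
      | exact congrArg (fun x : Fin 1 => (Sum.inl (Sum.inr x) : TripleAdjunct a₁ b₁ a₂ b₂ a₃ b₃))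
          (Subsingleton.elim x y)
      | exact congrArg (fun x : Fin 1 =>
          (Sum.inl (Sum.inl (Sum.inr x)) : TripleAdjunct a₁ b₁ a₂ b₂ a₃ b₃))
          (Subsingleton.elim x y)
      | exact congrArg (fun x : Fin 5 =>
          (Sum.inl (Sum.inl (Sum.inl x)) : TripleAdjunct a₁ b₁ a₂ b₂ a₃ b₃)) e
      | exact (h₁₂ (Prod.ext e e')).elim
      | exact (h₁₂ (Prod.ext e.symm e'.symm)).elim
      | exact (h₁₃ (Prod.ext e e')).elim
      | exact (h₁₃ (Prod.ext e.symm e'.symm)).elim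
      | exact (h₂₃ (Prod.ext e e')).elim
      | exact (h₂₃ (Prod.ext e.symm e'.symm)).elim
      | exact absurd (e.symm.trans e') h₁.ne
      | exact absurd (e.symm.trans e') h₂.ne
      | exact absurd (e.symm.trans e') h₃.ne
      | exact absurd (e.trans e'.symm) h₁.ne
      | exact absurd (e.trans e'.symm) h₂.ne
      | exact absurd (e.trans e'.symm) h₃.ne
  · rintro (((x | x) | x) | x)
    exacts [Nat.succ_ne_self _, g₁.ne, g₂.ne, g₃.ne]

theorem tripleAdjunct_longSupport (g₁ : (a₁ : ℕ) + 1 < b₁) (g₂ : (a₂ : ℕ) + 1 < b₂)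
    (g₃ : (a₃ : ℕ) + 1 < b₃) :
    (tripleAdjunct a₁ b₁ a₂ b₂ a₃ b₃ h₁ h₂ h₃ h₁₂ h₁₃ h₂₃).LongSupport
      {(a₁, b₁), (a₂, b₂), (a₃, b₃)} := by
  intro i j
  simp only [Finset.mem_insert, Finset.mem_singleton, Prod.mk.injEq]
  constructor
  · rintro (⟨rfl, rfl⟩ | ⟨rfl, rfl⟩ | ⟨rfl, rfl⟩)
    · exact ⟨g₁, Sum.inl (Sum.inl (Sum.inr 0)), rfl, rfl⟩
    · exact ⟨g₂, Sum.inl (Sum.inr 0), rfl, rfl⟩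
    · exact ⟨g₃, Sum.inr 0, rfl, rfl⟩
  · rintro ⟨hij, (((x | x) | x) | x), rfl, rfl⟩
    · exact absurd hij (by simp [tripleAdjunct])
    · exact .inl ⟨rfl, rfl⟩
    · exact .inr (.inl ⟨rfl, rfl⟩)
    · exact .inr (.inr ⟨rfl, rfl⟩)

end TripleAdjunct

/-! ### The cardinalities of the fibres -/

section Count

variable {n : ℕ}

/-- The number of elements with a given label. -/
noncomputable def count {T : Type u} [LE T] (ℓ : IntervalLabelling T n) (p : Fin n × Fin n) : ℕ :=
  Nat.card {x : T // ℓ.lo x = p.1 ∧ ℓ.hi x = p.2}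

theorem count_map {T : Type u} {T' : Type v} [LE T] [LE T'] (ℓ : IntervalLabelling T n)
    (e : T' ≃o T) (p : Fin n × Fin n) : (ℓ.map e).count p = ℓ.count p :=
  Nat.card_congr (e.toEquiv.subtypeEquiv fun _ => Iff.rfl)

theorem sum_count {T : Type u} [LE T] [Finite T] (ℓ : IntervalLabelling T n) :
    ∑ p, ℓ.count p = Nat.card T := by
  rw [← Nat.card_congr (Equiv.sigmaFiberEquiv fun x => (ℓ.lo x, ℓ.hi x)), Nat.card_sigma]
  refine Finset.sum_congr rfl fun p _ => Nat.card_congr (Equiv.subtypeEquivRight fun x => ?_)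
  rw [Prod.ext_iff]

theorem count_diag {T : Type u} [PartialOrder T] (ℓ : IntervalLabelling T n) (i : Fin n) :
    ℓ.count (i, i) = 1 := by
  rw [count, Nat.card_eq_one_iff_unique]
  refine ⟨⟨?_⟩, ⟨⟨ℓ.vtx i, by simp⟩⟩⟩
  rintro ⟨x, hx, hx'⟩ ⟨y, hy, hy'⟩
  refine Subtype.ext ?_
  change x = y
  rw [ℓ.eq_vtx (hx.trans hx'.symm), ℓ.eq_vtx (hy.trans hy'.symm), hx, hy]

theorem count_eq_zero_of_lt {T : Type u} [LE T] (ℓ : IntervalLabelling T n) {i j : Fin n}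
    (h : j < i) : ℓ.count (i, j) = 0 := by
  have : IsEmpty {x : T // ℓ.lo x = i ∧ ℓ.hi x = j} :=
    ⟨fun x => (ℓ.lo_le_hi x.1).not_gt (by rw [x.2.1, x.2.2]; exact h)⟩
  exact Nat.card_of_isEmpty

theorem count_ne_zero_iff {T : Type u} [LE T] [Finite T] (ℓ : IntervalLabelling T n)
    {i j : Fin n} : ℓ.count (i, j) ≠ 0 ↔ ∃ x, ℓ.lo x = i ∧ ℓ.hi x = j := by
  rw [count, Nat.card_ne_zero]
  exact ⟨fun ⟨⟨x⟩, _⟩ => ⟨x.1, x.2⟩, fun ⟨x, hx⟩ => ⟨⟨⟨x, hx⟩⟩, inferInstance⟩⟩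

theorem nonempty_fibre_orderIso {T : Type u} [PartialOrder T] [Finite T]
    (ℓ : IntervalLabelling T n) (p : Fin n × Fin n) :
    Nonempty ({x : T // ℓ.lo x = p.1 ∧ ℓ.hi x = p.2} ≃o Fin (ℓ.count p)) := by
  classical
  have := Fintype.ofFinite {x : T // ℓ.lo x = p.1 ∧ ℓ.hi x = p.2}
  let _ : LinearOrder {x : T // ℓ.lo x = p.1 ∧ ℓ.hi x = p.2} :=
    { (inferInstance : PartialOrder {x : T // ℓ.lo x = p.1 ∧ ℓ.hi x = p.2}) with
      le_total := fun x y => ℓ.total (x.2.1.trans y.2.1.symm) (x.2.2.trans y.2.2.symm)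
      toDecidableLE := Classical.decRel _ }
  exact ⟨(Fintype.orderIsoFinOfCardEq _ Nat.card_eq_fintype_card.symm).symm⟩

/-- Labelled posets with fibres of the same cardinalities are isomorphic. -/
theorem nonempty_orderIso_of_count {T : Type u} {T' : Type v} [PartialOrder T] [PartialOrder T']
    [Finite T] [Finite T'] (ℓ : IntervalLabelling T n) (ℓ' : IntervalLabelling T' n)
    (h : ∀ p, ℓ.count p = ℓ'.count p) : Nonempty (T ≃o T') := by
  have key2 : ∀ p : Fin n × Fin n, Nonempty ({x : T // ℓ.lo x = p.1 ∧ ℓ.hi x = p.2} ≃o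
      {x : T' // ℓ'.lo x = p.1 ∧ ℓ'.hi x = p.2}) := by
    intro p
    obtain ⟨e⟩ := ℓ.nonempty_fibre_orderIso p
    obtain ⟨e'⟩ := ℓ'.nonempty_fibre_orderIso p
    rw [h p] at e
    exact ⟨e.trans e'.symm⟩
  let e := fun p => (key2 p).some
  let f : T → T' := fun x => (e (ℓ.lo x, ℓ.hi x) ⟨x, rfl, rfl⟩).1
  have hf : ∀ p x (hx : ℓ.lo x = p.1 ∧ ℓ.hi x = p.2), f x = (e p ⟨x, hx⟩).1 := by
    rintro ⟨i, j⟩ x ⟨hi, hj⟩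
    dsimp only at hi hj
    subst hi hj
    rfl
  have hlo : ∀ x, ℓ'.lo (f x) = ℓ.lo x := fun x => (e _ ⟨x, rfl, rfl⟩).2.1
  have hhi : ∀ x, ℓ'.hi (f x) = ℓ.hi x := fun x => (e _ ⟨x, rfl, rfl⟩).2.2
  have hle : ∀ x y, f x ≤ f y ↔ x ≤ y := by
    refine le_iff_of_labels ℓ ℓ' f hlo hhi fun x y h1 h2 => ?_
    rw [hf (ℓ.lo y, ℓ.hi y) x ⟨h1, h2⟩]
    exact (e _).le_iff_le (x := ⟨x, h1, h2⟩) (y := ⟨y, rfl, rfl⟩)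
  refine ⟨⟨Equiv.ofBijective f ⟨?_, ?_⟩, hle _ _⟩⟩
  · intro x y hxy
    exact le_antisymm ((hle _ _).1 hxy.le) ((hle _ _).1 hxy.ge)
  · intro y
    refine ⟨((e (ℓ'.lo y, ℓ'.hi y)).symm ⟨y, rfl, rfl⟩).1, ?_⟩
    rw [hf (ℓ'.lo y, ℓ'.hi y) _ ((e (ℓ'.lo y, ℓ'.hi y)).symm ⟨y, rfl, rfl⟩).2]
    simp

/-- The labels of a lattice whose vertices are the reducible elements are invariant under
isomorphism. -/
theorem count_eq_of_orderIso {L : Type u} {L' : Type v} [Lattice L] [Lattice L']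
    {ℓ : IntervalLabelling L n} {ℓ' : IntervalLabelling L' n}
    (h : redSet L = Set.range ℓ.vtx) (h' : redSet L' = Set.range ℓ'.vtx) (φ : L ≃o L')
    (p : Fin n × Fin n) : ℓ.count p = ℓ'.count p := by
  have hred : ∀ x, x ∈ redSet L → φ x ∈ redSet L' := by
    rintro x (⟨y, z, hy, hz, rfl⟩ | ⟨y, z, hy, hz, rfl⟩)
    · exact .inl ⟨φ y, φ z, φ.injective.ne hy, φ.injective.ne hz, (map_sup φ y z).symm⟩
    · exact .inr ⟨φ y, φ z, φ.injective.ne hy, φ.injective.ne hz, (map_inf φ y z).symm⟩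
  have hred' : ∀ x, x ∈ redSet L' → φ.symm x ∈ redSet L := by
    rintro x (⟨y, z, hy, hz, rfl⟩ | ⟨y, z, hy, hz, rfl⟩)
    · exact .inl ⟨_, _, φ.symm.injective.ne hy, φ.symm.injective.ne hz, (map_sup φ.symm y z).symm⟩
    · exact .inr ⟨_, _, φ.symm.injective.ne hy, φ.symm.injective.ne hz, (map_inf φ.symm y z).symm⟩
  have h1 : ∀ i, ∃ k, ℓ'.vtx k = φ (ℓ.vtx i) := fun i => by
    have := hred (ℓ.vtx i) (by rw [h]; exact ⟨i, rfl⟩)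
    rwa [h'] at this
  have h2 : ∀ i, ∃ k, ℓ.vtx k = φ.symm (ℓ'.vtx i) := fun i => by
    have := hred' (ℓ'.vtx i) (by rw [h']; exact ⟨i, rfl⟩)
    rwa [h] at this
  choose σ hσ using h1
  choose τ hτ using h2
  have hσm : StrictMono σ := fun i j hij => by
    rw [← ℓ'.vtx_lt_vtx, hσ, hσ, φ.lt_iff_lt, ℓ.vtx_lt_vtx]
    exact hij
  have hτm : StrictMono τ := fun i j hij => by
    rw [← ℓ.vtx_lt_vtx, hτ, hτ, φ.symm.lt_iff_lt, ℓ'.vtx_lt_vtx]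
    exact hij
  -- The isomorphism permutes the vertices increasingly, with increasing inverse, so it fixes every
  -- index. Labels are then preserved, being determined by the vertices below and above an element.
  have hσ' : ∀ i, σ i = i := fun i => by
    apply le_antisymm _ hσm.le_apply
    have : τ (σ i) = i := ℓ.vtx_injective (by rw [hτ, hσ, φ.symm_apply_apply])
    conv_rhs => rw [← this]
    exact hτm.le_apply
  have hv : ∀ i, ℓ'.vtx i = φ (ℓ.vtx i) := fun i => by rw [← hσ, hσ']
  have hlo : ∀ x, ℓ'.lo (φ x) = ℓ.lo x := fun x => eq_of_forall_le_iff fun i => by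
    rw [← ℓ'.vtx_le_iff, hv, φ.le_iff_le, ℓ.vtx_le_iff]
  have hhi : ∀ x, ℓ'.hi (φ x) = ℓ.hi x := fun x => eq_of_forall_ge_iff fun i => by
    rw [← ℓ'.le_vtx_iff, hv, φ.le_iff_le, ℓ.le_vtx_iff]
  exact Nat.card_congr (φ.toEquiv.subtypeEquiv fun x => by
    change _ ↔ ℓ'.lo (φ x) = _ ∧ ℓ'.hi (φ x) = _
    rw [hlo, hhi])

end Count

/-! ### Existence of lattices with given fibres -/

section Model

variable {n : ℕ}

/-- A common upper bound `b` of incomparable `x`, `y` cannot lie in the fibre of either: if it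
shared the fibre of `x`, then `y` would be below that fibre or in it, hence comparable with `x`. So
`b` lies above both end vertices. -/
theorem exists_lub {T : Type u} [PartialOrder T] (ℓ : IntervalLabelling T n) (x y : T) :
    ∃ z, x ≤ z ∧ y ≤ z ∧ ∀ b, x ≤ b → y ≤ b → z ≤ b := by
  by_cases h1 : x ≤ y
  · exact ⟨y, h1, le_rfl, fun _ _ h => h⟩
  by_cases h2 : y ≤ x
  · exact ⟨x, le_rfl, h2, fun _ h _ => h⟩
  refine ⟨ℓ.vtx (max (ℓ.hi x) (ℓ.hi y)), ℓ.le_vtx_iff.2 (le_max_left _ _),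
    ℓ.le_vtx_iff.2 (le_max_right _ _), fun b hx hy => ?_⟩
  have key : ∀ {x y : T}, ¬ x ≤ y → ¬ y ≤ x → x ≤ b → y ≤ b → ℓ.hi x ≤ ℓ.lo b := by
    intro x y h1 h2 hx hy
    rcases ℓ.of_le hx with h | h
    · exact h
    · rcases ℓ.of_le hy with h' | h'
      · exact absurd (ℓ.le_of (by rw [h.1]; exact h')) h2
      · exact absurd (ℓ.total (h.1.trans h'.1.symm) (h.2.trans h'.2.symm)) (by tauto)
  exact ℓ.vtx_le_iff.2 (max_le (key h1 h2 hx hy) (key h2 h1 hy hx))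

theorem exists_glb {T : Type u} [PartialOrder T] (ℓ : IntervalLabelling T n) (x y : T) :
    ∃ z, z ≤ x ∧ z ≤ y ∧ ∀ b, b ≤ x → b ≤ y → b ≤ z := by
  by_cases h1 : x ≤ y
  · exact ⟨x, le_rfl, h1, fun _ h _ => h⟩
  by_cases h2 : y ≤ x
  · exact ⟨y, h2, le_rfl, fun _ _ h => h⟩
  refine ⟨ℓ.vtx (min (ℓ.lo x) (ℓ.lo y)), ℓ.vtx_le_iff.2 (min_le_left _ _),
    ℓ.vtx_le_iff.2 (min_le_right _ _), fun b hx hy => ?_⟩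
  have key : ∀ {x y : T}, ¬ x ≤ y → ¬ y ≤ x → b ≤ x → b ≤ y → ℓ.hi b ≤ ℓ.lo x := by
    intro x y h1 h2 hx hy
    rcases ℓ.of_le hx with h | h
    · exact h
    · rcases ℓ.of_le hy with h' | h'
      · exact absurd (ℓ.le_of (by rw [← h.2]; exact h')) h1
      · exact absurd (ℓ.total (h.1.symm.trans h'.1) (h.2.symm.trans h'.2)) (by tauto)
  exact ℓ.le_vtx_iff.2 (le_min (key h1 h2 hx hy) (key h2 h1 hy hx))

/-- A labelled poset is a lattice: the join of two incomparable elements is a vertex. -/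
noncomputable abbrev toLattice {T : Type u} [PartialOrder T] (ℓ : IntervalLabelling T n) :
    Lattice T :=
  { (inferInstance : PartialOrder T) with
    sup := fun x y => (ℓ.exists_lub x y).choose
    le_sup_left := fun x y => (ℓ.exists_lub x y).choose_spec.1
    le_sup_right := fun x y => (ℓ.exists_lub x y).choose_spec.2.1
    sup_le := fun x y => (ℓ.exists_lub x y).choose_spec.2.2
    inf := fun x y => (ℓ.exists_glb x y).choose
    inf_le_left := fun x y => (ℓ.exists_glb x y).choose_spec.1
    inf_le_right := fun x y => (ℓ.exists_glb x y).choose_spec.2.1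
    le_inf := fun x y z => (ℓ.exists_glb y z).choose_spec.2.2 x }

/-- The carrier of the poset with a chain of `w (i, j)` elements for every label `(i, j)`. -/
@[ext] structure Model (w : Fin n × Fin n → ℕ) where
  lo : Fin n
  hi : Fin n
  idx : ℕ
  idx_lt : idx < w (lo, hi)

namespace Model

variable {w : Fin n × Fin n → ℕ}

/-- The elements of the model as a disjoint union of chains. -/
def equivSigma (w : Fin n × Fin n → ℕ) : Model w ≃ Σ p, Fin (w p) where
  toFun x := ⟨(x.lo, x.hi), ⟨x.idx, x.idx_lt⟩⟩
  invFun x := ⟨x.1.1, x.1.2, x.2, x.2.2⟩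
  left_inv _ := rfl
  right_inv _ := rfl

instance : Finite (Model w) := Finite.of_equiv _ (equivSigma w).symm

theorem natCard_eq : Nat.card (Model w) = ∑ p, w p := by
  rw [Nat.card_congr (equivSigma w), Nat.card_sigma]
  simp

theorem lo_le_hi (h0 : ∀ i j, j < i → w (i, j) = 0) (x : Model w) : x.lo ≤ x.hi := by
  by_contra hlt
  have h1 := x.idx_lt
  rw [h0 _ _ (not_le.1 hlt)] at h1
  omega

theorem idx_eq_zero (h1 : ∀ i, w (i, i) = 1) (x : Model w) (hx : x.lo = x.hi) : x.idx = 0 := by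
  have h2 := x.idx_lt
  rw [hx, h1] at h2
  omega

/-- The order on the model. -/
abbrev partialOrder (h1 : ∀ i, w (i, i) = 1) (h0 : ∀ i j, j < i → w (i, j) = 0) :
    PartialOrder (Model w) where
  le x y := x.hi ≤ y.lo ∨ (x.lo = y.lo ∧ x.hi = y.hi ∧ x.idx ≤ y.idx)
  le_refl x := .inr ⟨rfl, rfl, le_rfl⟩
  le_trans := by
    rintro x y z (h | ⟨h, h', h''⟩) (g | ⟨g, g', g''⟩)
    · exact .inl (h.trans ((lo_le_hi h0 y).trans g))
    · exact .inl (by rw [← g]; exact h)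
    · exact .inl (by rw [h']; exact g)
    · exact .inr ⟨h.trans g, h'.trans g', h''.trans g''⟩
  le_antisymm := by
    -- Mutual inequalities between labels collapse both intervals to the same point, where the fibre
    -- has a single element of index 0.
    have hself : ∀ x y : Model w, x.hi ≤ y.lo → y.hi ≤ x.lo → x = y := by
      intro x y h g
      have e1 := le_antisymm (lo_le_hi h0 x) (h.trans ((lo_le_hi h0 y).trans g))
      have e2 := le_antisymm (lo_le_hi h0 y) (g.trans ((lo_le_hi h0 x).trans h))
      have e3 := le_antisymm h (by rw [← e1, e2]; exact g)
      exact Model.ext (e1.trans e3) (e3.trans e2)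
        (by rw [idx_eq_zero h1 x e1, idx_eq_zero h1 y e2])
    rintro x y (h | ⟨h, h', h''⟩) (g | ⟨g, g', g''⟩)
    · exact hself x y h g
    · exact hself x y h (by rw [g', ← g]; exact h)
    · exact hself x y (by rw [h', ← h]; exact g) g
    · exact Model.ext h h' (le_antisymm h'' g'')

end Model

/-- The tautological labelling of the model. -/
def modelLabelling {w : Fin n × Fin n → ℕ} (h1 : ∀ i, w (i, i) = 1)
    (h0 : ∀ i j, j < i → w (i, j) = 0) :
    @IntervalLabelling (Model w) (Model.partialOrder h1 h0).toLE n :=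
  letI := Model.partialOrder h1 h0
  { lo := Model.lo
    hi := Model.hi
    lo_le_hi := Model.lo_le_hi h0
    le_of := fun h => .inl h
    of_le := fun h => h.imp id fun h => ⟨h.1, h.2.1⟩
    total := fun {x y} h h' => (le_total x.idx y.idx).imp
      (fun g => .inr ⟨h, h', g⟩) fun g => .inr ⟨h.symm, h'.symm, g⟩
    vtx := fun i => ⟨i, i, 0, by rw [h1]; omega⟩
    lo_vtx := fun _ => rfl
    hi_vtx := fun _ => rfl }

/-- Every admissible family of fibre cardinalities is realised by a lattice. -/
theorem exists_lattice (w : Fin n × Fin n → ℕ) (h1 : ∀ i, w (i, i) = 1)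
    (h0 : ∀ i j, j < i → w (i, j) = 0) :
    ∃ (T : Type) (_ : Lattice T) (_ : Finite T) (ℓ : IntervalLabelling T n),
      Nat.card T = ∑ p, w p ∧ ∀ p, ℓ.count p = w p := by
  let _ := Model.partialOrder h1 h0
  let ℓ := modelLabelling h1 h0
  refine ⟨Model w, ℓ.toLattice, inferInstance, ℓ, Model.natCard_eq, fun p => ?_⟩
  have e : Fin (w p) ≃ {x : Model w // x.lo = p.1 ∧ x.hi = p.2} :=
    { toFun := fun k => ⟨⟨p.1, p.2, k, k.2⟩, rfl, rfl⟩
      invFun := fun x => ⟨x.1.idx, by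
        have := x.1.idx_lt
        rwa [x.2.1, x.2.2] at this⟩
      left_inv := fun _ => rfl
      right_inv := fun x => Subtype.ext (Model.ext x.2.1.symm x.2.2.symm rfl) }
  exact (Nat.card_congr e.symm).trans (Nat.card_fin _)

end Model

end IntervalLabelling

open IntervalLabelling

/-! ### The blocks with a given basic block -/

/-- A lattice with an associated basic block isomorphic to a labelled ordered set is labelled. -/
theorem HasBasicBlock.exists_labelling {B : Type v} [LE B] {j : ℕ} {L : Type u} [Lattice L]
    (h : HasBasicBlock B j L) {n : ℕ} {P : Finset (Fin n × Fin n)} {ℓB : IntervalLabelling B n}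
    (hP : ℓB.LongSupport P) : Finite L ∧ ∃ ℓ : IntervalLabelling L n, ℓ.LongSupport P := by
  obtain ⟨⟨h0, hcard, hblock, -⟩, S, hS, ⟨e⟩⟩ := h
  have : Finite L := Nat.finite_of_card_ne_zero (by omega)
  exact ⟨this, hS.exists_labelling hblock.minDegreeTwo ⟨ℓB.map e, hP.map e⟩⟩

/-- A labelled lattice with the same long support as a basic `B` has associated basic block `B`. -/
theorem hasBasicBlock_of_labelling {B : Type v} [LE B] {P E : Finset (Fin 5 × Fin 5)}
    {ℓB : IntervalLabelling B 5} (hPB : ℓB.LongSupport P) (hbB : ℓB.Basic) (hP : Spanning P)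
    (hE : ∀ i j : Fin 5, (i, j) ∈ E ↔ (i : ℕ) + 1 = j ∨ (i, j) ∈ P) (hcard : E.card = 7)
    {L : Type u} [Lattice L] [Finite L] {ℓ : IntervalLabelling L 5} (h : ℓ.LongSupport P) :
    HasBasicBlock B (Nat.card L) L := by
  refine ⟨isMaximalBlock (by norm_num) h hP hE (by omega), ?_⟩
  obtain ⟨S, hS, ℓ', hℓ', hb⟩ := exists_isBasicBlockOf h hP
  exact ⟨S, hS, hb.nonempty_orderIso hbB hℓ' hPB⟩

/-- `Fin j` with a given lattice structure. -/
def LatticeFin {j : ℕ} (_ : Lattice (Fin j)) : Type := Fin j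

instance {j : ℕ} (L : Lattice (Fin j)) : Lattice (LatticeFin L) := L

instance {j : ℕ} (L : Lattice (Fin j)) : Finite (LatticeFin L) := inferInstanceAs (Finite (Fin j))

theorem natCard_latticeFin {j : ℕ} (L : Lattice (Fin j)) : Nat.card (LatticeFin L) = j :=
  Nat.card_fin j

theorem exists_latticeFin {j : ℕ} {T : Type u} [Lattice T] [Finite T] (h : Nat.card T = j) :
    ∃ L : Lattice (Fin j), Nonempty (LatticeFin L ≃o T) := by
  subst h
  let e := (Finite.equivFin T).symm
  let L : Lattice (Fin (Nat.card T)) :=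
    { PartialOrder.lift e e.injective with
      sup := fun x y => e.symm (e x ⊔ e y)
      inf := fun x y => e.symm (e x ⊓ e y)
      le_sup_left := fun x y => show e x ≤ e _ by simp
      le_sup_right := fun x y => show e y ≤ e _ by simp
      sup_le := fun x y z (hx : e x ≤ e z) (hy : e y ≤ e z) => show e _ ≤ e z by simp [hx, hy]
      inf_le_left := fun x y => show e _ ≤ e x by simp
      inf_le_right := fun x y => show e _ ≤ e y by simp
      le_inf := fun x y z (hy : e x ≤ e y) (hz : e x ≤ e z) => show e x ≤ e _ by simp [hy, hz] }
  exact ⟨L, ⟨⟨e, Iff.rfl⟩⟩⟩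

/-- The number of blocks with a given basic block, as a number of compositions. -/
theorem numBlocks_eq_card {B : Type v} [LE B] {P E : Finset (Fin 5 × Fin 5)}
    {ℓB : IntervalLabelling B 5} (hPB : ℓB.LongSupport P) (hbB : ℓB.Basic) (hP : Spanning P)
    (hE : ∀ i j : Fin 5, (i, j) ∈ E ↔ (i : ℕ) + 1 = j ∨ (i, j) ∈ P) (hcard : E.card = 7)
    (hdiag : (Finset.univ.filter fun p : Fin 5 × Fin 5 => p.1 = p.2 ∨ p ∈ P).card = 8)
    {j : ℕ} (hj : 8 ≤ j) : numBlocks B j = (E.finsuppAntidiag (j - 8)).card := by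
  classical
  -- The least admissible fibre sizes: one for each of the five vertices and one for each of the
  -- three long pairs, 8 in total.
  let base : Fin 5 × Fin 5 → ℕ := fun p => if p.1 = p.2 ∨ p ∈ P then 1 else 0
  have hbase : ∑ p, base p = 8 := by
    rw [← hdiag, Finset.card_filter]
  have hlong : ∀ i k : Fin 5, (i, k) ∈ P → (i : ℕ) + 1 < k := fun i k h => ((hPB i k).1 h).1
  have hEdiag : ∀ i k : Fin 5, (i, k) ∈ E → i < k := fun i k h => by
    rw [Fin.lt_def]
    rcases (hE i k).1 h with h | h
    · omega
    · have := hlong i k h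
      omega
  -- A distribution `f` of the spare elements over short and long pairs is realised by the lattice
  -- with fibre sizes `f + base`.
  have key : ∀ f : E.finsuppAntidiag (j - 8), ∃ L : {L : Lattice (Fin j) //
      @HasBasicBlock B _ j (Fin j) L}, ∃ ℓ : IntervalLabelling (LatticeFin L.1) 5,
      ℓ.LongSupport P ∧ ∀ p, ℓ.count p = f.1 p + base p := by
    rintro ⟨f, hf⟩
    obtain ⟨hsum, hsupp⟩ := Finset.mem_finsuppAntidiag.1 hf
    have hf0 : ∀ p, p ∉ E → f p = 0 := fun p hp => Finsupp.notMem_support_iff.1 fun h => hp (hsupp h)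
    obtain ⟨T, _, _, ℓ, hT, hℓ⟩ := exists_lattice (fun p => f p + base p)
      (fun i => by
        rw [hf0 _ fun h => (hEdiag _ _ h).ne rfl]
        simp [base])
      (fun i k hik => by
        rw [hf0 _ fun h => (hEdiag _ _ h).not_gt hik]
        simp only [base, Nat.zero_add, ite_eq_right_iff, one_ne_zero, imp_false]
        rintro (h | h)
        · exact hik.ne' h
        · have := hlong _ _ h
          rw [Fin.lt_def] at hik
          omega)
    have hTj : Nat.card T = j := by
      rw [hT, Finset.sum_add_distrib, hbase, ← Finset.sum_subset (Finset.subset_univ E)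
        fun p _ hp => hf0 p hp]
      have : ∑ p ∈ E, f p = j - 8 := hsum
      omega
    have hlong' : ℓ.LongSupport P := by
      intro i k
      rw [← ℓ.count_ne_zero_iff, hℓ]
      constructor
      · intro h
        refine ⟨hlong _ _ h, ?_⟩
        simp [base, h]
      · rintro ⟨hik, hne⟩
        by_contra hnP
        have h1 : (i, k) ∉ E := fun h => by
          rcases (hE i k).1 h with h | h
          · omega
          · exact hnP h
        rw [hf0 _ h1] at hne
        have h2 : i ≠ k := by
          rintro rfl
          omega
        simp [base, hnP, h2] at hne
    obtain ⟨L, ⟨e⟩⟩ := exists_latticeFin hTj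
    refine ⟨⟨L, ?_⟩, ℓ.map e, hlong'.map e, fun p => by rw [count_map, hℓ]⟩
    have := hasBasicBlock_of_labelling hPB hbB hP hE hcard (hlong'.map e)
    rwa [natCard_latticeFin] at this
  choose L ℓ hℓP hℓ using key
  have hbij : Function.Bijective fun f => (Quotient.mk (blockSetoid B j) (L f)) := by
    constructor
    · intro f g hfg
      obtain ⟨φ⟩ := Quotient.exact hfg
      have hc := count_eq_of_orderIso (redSet_eq (hℓP f) hP) (redSet_eq (hℓP g) hP) φ
      refine Subtype.ext (Finsupp.ext fun p => ?_)
      have := hc p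
      rw [hℓ, hℓ] at this
      omega
    · intro q
      induction q using Quotient.inductionOn with
      | _ M =>
        obtain ⟨-, ℓM, hM⟩ := HasBasicBlock.exists_labelling (L := LatticeFin M.1) M.2 hPB
        have hle : ∀ p, base p ≤ ℓM.count p := by
          rintro ⟨i, k⟩
          by_cases hik : i = k
          · subst hik
            simp [base, count_diag]
          · by_cases hp : (i, k) ∈ P
            · have := ℓM.count_ne_zero_iff.2 ((hM i k).1 hp).2
              simp only [base, hp, or_true, if_true]
              omega
            · simp [base, hik, hp]
        -- The excess of the fibre sizes over the least ones; by `hle` the truncated subtraction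
        -- loses nothing.
        let f : Fin 5 × Fin 5 →₀ ℕ :=
          Finsupp.equivFunOnFinite.symm fun p => ℓM.count p - base p
        have hfp : ∀ p, f p = ℓM.count p - base p := fun p => rfl
        have hf0 : ∀ p, p ∉ E → f p = 0 := by
          rintro ⟨i, k⟩ hp
          rw [hfp]
          rcases lt_trichotomy i k with hik | rfl | hik
          · have : ℓM.count (i, k) = 0 := by
              by_contra hne
              rw [hE, not_or] at hp
              refine hp.2 ((hM i k).2 ⟨?_, ℓM.count_ne_zero_iff.1 hne⟩)
              rw [Fin.lt_def] at hik
              omega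
            omega
          · rw [count_diag]
            simp [base]
          · rw [count_eq_zero_of_lt _ hik]
            omega
        have hsum : ∑ p ∈ E, f p = j - 8 := by
          rw [Finset.sum_subset (Finset.subset_univ E) fun p _ hp => hf0 p hp]
          have h1 : ∑ p, (f p + base p) = j := by
            rw [← natCard_latticeFin M.1, ← ℓM.sum_count]
            exact Finset.sum_congr rfl fun p _ => by rw [hfp, Nat.sub_add_cancel (hle p)]
          rw [Finset.sum_add_distrib, hbase] at h1
          omega
        have hf : f ∈ E.finsuppAntidiag (j - 8) := Finset.mem_finsuppAntidiag.2
          ⟨hsum, fun p hp => by_contra fun h => Finsupp.mem_support_iff.1 hp (hf0 p h)⟩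
        refine ⟨⟨f, hf⟩, Quotient.sound ?_⟩
        obtain ⟨φ⟩ := nonempty_orderIso_of_count (ℓ ⟨f, hf⟩) ℓM fun p => by
          rw [hℓ]
          change f p + base p = _
          rw [hfp, Nat.sub_add_cancel (hle p)]
        exact ⟨φ⟩
  rw [numBlocks, ← Nat.card_eq_of_bijective _ hbij, Nat.card_eq_fintype_card, Fintype.card_coe]

/-- The hockey-stick identity applied twice: the inner upper indices `j - t - s - 2` run over `4, …,
j - s - 3`, and the resulting `j - s - 2` over `5, …, j - 3`. -/
theorem sum_sum_choose (j : ℕ) (hj : 8 ≤ j) :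
    ∑ s ∈ Finset.Icc 1 (j - 7), ∑ t ∈ Finset.Icc 1 (j - s - 6), (j - t - s - 2).choose 4 =
      (j - 2).choose 6 := by
  have h1 : ∀ s ∈ Finset.Icc 1 (j - 7),
      ∑ t ∈ Finset.Icc 1 (j - s - 6), (j - t - s - 2).choose 4 = (j - s - 2).choose 5 := by
    intro s hs
    rw [Finset.mem_Icc] at hs
    have h := Nat.sum_Icc_choose (j - s - 3) 4
    rw [show j - s - 3 + 1 = j - s - 2 by omega] at h
    rw [← h]
    refine Finset.sum_nbij' (fun t => j - t - s - 2) (fun v => j - v - s - 2) ?_ ?_ ?_ ?_ ?_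
    all_goals intro t ht
    all_goals rw [Finset.mem_Icc] at ht
    all_goals first
      | rfl
      | (rw [Finset.mem_Icc]; omega)
      | omega
  rw [Finset.sum_congr rfl h1]
  have h := Nat.sum_Icc_choose (j - 3) 5
  rw [show j - 3 + 1 = j - 2 by omega] at h
  rw [← h]
  refine Finset.sum_nbij' (fun t => j - t - 2) (fun v => j - v - 2) ?_ ?_ ?_ ?_ ?_
  all_goals intro t ht
  all_goals rw [Finset.mem_Icc] at ht
  all_goals first
    | rfl
    | (rw [Finset.mem_Icc]; omega)
    | omega

theorem numBlocks_tripleAdjunct {a₁ b₁ a₂ b₂ a₃ b₃ : Fin 5} (g₁ : (a₁ : ℕ) + 1 < b₁)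
    (g₂ : (a₂ : ℕ) + 1 < b₂) (g₃ : (a₃ : ℕ) + 1 < b₃)
    (h₁₂ : (a₁, b₁) ≠ (a₂, b₂)) (h₁₃ : (a₁, b₁) ≠ (a₃, b₃)) (h₂₃ : (a₂, b₂) ≠ (a₃, b₃))
    (hP : ∀ i : Fin 5, ∃ p ∈ ({(a₁, b₁), (a₂, b₂), (a₃, b₃)} : Finset (Fin 5 × Fin 5)),
      p.1 = i ∨ p.2 = i)
    (hcard : (Finset.univ.filter fun p : Fin 5 × Fin 5 => (p.1 : ℕ) + 1 = p.2 ∨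
      p ∈ ({(a₁, b₁), (a₂, b₂), (a₃, b₃)} : Finset (Fin 5 × Fin 5))).card = 7)
    (hdiag : (Finset.univ.filter fun p : Fin 5 × Fin 5 => p.1 = p.2 ∨
      p ∈ ({(a₁, b₁), (a₂, b₂), (a₃, b₃)} : Finset (Fin 5 × Fin 5))).card = 8)
    {j : ℕ} (hj : 8 ≤ j) : numBlocks (TripleAdjunct a₁ b₁ a₂ b₂ a₃ b₃) j =
      ∑ s ∈ Finset.Icc 1 (j - 7), ∑ t ∈ Finset.Icc 1 (j - s - 6), (j - t - s - 2).choose 4 := by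
  have hlt : ∀ {a b : Fin 5}, (a : ℕ) + 1 < b → a < b := fun h => by rw [Fin.lt_def]; omega
  rw [sum_sum_choose j hj, numBlocks_eq_card
    (tripleAdjunct_longSupport (h₁ := hlt g₁) (h₂ := hlt g₂) (h₃ := hlt g₃)
      (h₁₂ := h₁₂) (h₁₃ := h₁₃) (h₂₃ := h₂₃) g₁ g₂ g₃)
    (tripleAdjunct_basic g₁ g₂ g₃) hP (fun i j => by rw [Finset.mem_filter]; simp) hcard hdiag hj,
    Finset.card_finsuppAntidiag_nat_eq_choose, hcard, show 7 + (j - 8) - 1 = j - 2 by omega,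
    ← Nat.choose_symm (by omega), show j - 2 - (j - 8) = 6 by omega]

namespace IntervalLabelling

section Iic

variable {T : Type u} [PartialOrder T] {n : ℕ}

/-- The size `m` is a variable tied to `k + 1` by an equation, so that it can later be the numeral
4. -/
theorem hi_lt_of_le_vtx (ℓ : IntervalLabelling T n) {k : Fin n} {m : ℕ} (hm : m = k + 1) {x : T}
    (hx : x ≤ ℓ.vtx k) : (ℓ.hi x : ℕ) < m := by
  have h2 := ℓ.le_vtx_iff.1 hx
  rw [Fin.le_def] at h2
  omega

/-- The restriction of a labelling to the elements below a vertex. -/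
def iic (ℓ : IntervalLabelling T n) (k : Fin n) {m : ℕ} (hm : m = k + 1) :
    IntervalLabelling (Set.Iic (ℓ.vtx k)) m where
  lo x := (ℓ.lo x.1).castLT (lt_of_le_of_lt (ℓ.lo_le_hi x.1) (ℓ.hi_lt_of_le_vtx hm x.2))
  hi x := (ℓ.hi x.1).castLT (ℓ.hi_lt_of_le_vtx hm x.2)
  lo_le_hi x := ℓ.lo_le_hi x.1
  le_of h := Subtype.coe_le_coe.1 (ℓ.le_of h)
  of_le h := (ℓ.of_le (Subtype.coe_le_coe.2 h)).imp id fun h =>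
    ⟨Fin.ext (by simp [h.1]), Fin.ext (by simp [h.2])⟩
  total {x y} h h' := by
    have e : ℓ.lo x.1 = ℓ.lo y.1 := Fin.ext (by simpa using congrArg Fin.val h)
    have e' : ℓ.hi x.1 = ℓ.hi y.1 := Fin.ext (by simpa using congrArg Fin.val h')
    exact ℓ.total e e'
  vtx i := ⟨ℓ.vtx (i.castLE (by omega)), ℓ.vtx_le_vtx.2 (by
    rw [Fin.le_def, Fin.val_castLE]
    omega)⟩
  lo_vtx i := Fin.ext (by simp)
  hi_vtx i := Fin.ext (by simp)

theorem LongSupport.iic {ℓ : IntervalLabelling T n} {P : Finset (Fin n × Fin n)}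
    (h : ℓ.LongSupport P) (k : Fin n) {m : ℕ} (hm : m = k + 1) {P' : Finset (Fin m × Fin m)}
    (hP' : ∀ i j : Fin m, (i, j) ∈ P' ↔ (i.castLE (by omega), j.castLE (by omega)) ∈ P) :
    (ℓ.iic k hm).LongSupport P' := by
  intro i j
  rw [hP', h]
  refine and_congr Iff.rfl ⟨?_, ?_⟩
  · rintro ⟨x, hx, hx'⟩
    refine ⟨⟨x, ℓ.le_vtx_iff.2 ?_⟩, Fin.ext (congrArg Fin.val hx :),
      Fin.ext (congrArg Fin.val hx' :)⟩
    rw [hx', Fin.le_def, Fin.val_castLE]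
    omega
  · rintro ⟨x, hx, hx'⟩
    exact ⟨x.1, Fin.ext (congrArg Fin.val hx :), Fin.ext (congrArg Fin.val hx' :)⟩

end Iic

/-- The interval below the fourth vertex of a lattice labelled as the first basic block. -/
theorem isMaximalBlockOfHeight_Iic {L : Type u} [Lattice L] [Finite L] {ℓ : IntervalLabelling L 5}
    (h : ℓ.LongSupport {(0, 2), (1, 3), (1, 4)}) :
    IsMaximalBlockOfHeight (Set.Iic (ℓ.vtx 3)) (Nat.card (Set.Iic (ℓ.vtx 3))) 4 2 3 ∧
      6 ≤ Nat.card (Set.Iic (ℓ.vtx 3)) := by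
  have h' : (ℓ.iic 3 (m := 4) rfl).LongSupport {(0, 2), (1, 3)} := h.iic 3 rfl (by decide)
  have hP : Spanning ({(0, 2), (1, 3)} : Finset (Fin 4 × Fin 4)) := by
    unfold Spanning
    decide
  refine ⟨⟨isMaximalBlock (by norm_num) h' hP
    -- Three short and two long pairs over four vertices: the nullity is `5 - 4 + 1 = 2`.
    (E := {(0, 1), (1, 2), (2, 3), (0, 2), (1, 3)}) (by decide) (by decide), ?_⟩, ?_⟩
  · obtain ⟨S, hS, ℓ', -, hb⟩ := exists_isBasicBlockOf h' hP
    exact ⟨S, hS, hb.krullDim_eq⟩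
  · obtain ⟨-, x, hx, hx'⟩ := (h' 0 2).1 (by decide)
    obtain ⟨-, y, hy, hy'⟩ := (h' 1 3).1 (by decide)
    -- Members of the two long fibres are distinct nonvertices; with the four vertices they make six
    -- elements.
    have hnt : Nontrivial {x // (ℓ.iic 3 (m := 4) rfl).lo x ≠ (ℓ.iic 3 (m := 4) rfl).hi x} := by
      refine ⟨⟨x, by rw [hx, hx']; decide⟩, ⟨y, by rw [hy, hy']; decide⟩, fun e => ?_⟩
      have e' : x = y := congrArg Subtype.val e
      rw [e', hy] at hx
      exact absurd hx (by decide)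
    have h1 := Finite.one_lt_card_iff_nontrivial.2 hnt
    rw [card_eq (ℓ := ℓ.iic 3 (m := 4) rfl)]
    omega

section Decomposition

variable {L : Type u} [PartialOrder L] {ℓ : IntervalLabelling L 5}

theorem three_le_lo_of_vtx_lt {x : L} (hx : ℓ.vtx 3 < x) : 3 ≤ ℓ.lo x ∧ ℓ.hi x = 4 := by
  have h1 := ℓ.vtx_le_iff.1 hx.le
  refine ⟨h1, ?_⟩
  have h2 : ¬ ℓ.hi x ≤ 3 := fun h => (ℓ.le_vtx_iff.2 h).not_gt hx
  have h3 := (ℓ.hi x).isLt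
  rw [Fin.le_def] at h2
  exact Fin.ext (by simp at h2 ⊢; omega)

/-- Above vertex 3 the only labels are `(3, 4)` and `(4, 4)`: one fibre followed by the top vertex.
-/
theorem isChain_Ioi_vtx : IsChain (· ≤ ·) (Set.Ioi (ℓ.vtx 3)) := by
  intro x hx y hy _
  obtain ⟨h1, h2⟩ := three_le_lo_of_vtx_lt hx
  obtain ⟨h3, h4⟩ := three_le_lo_of_vtx_lt hy
  by_cases e : ℓ.lo x = ℓ.lo y
  · exact ℓ.total e (h2.trans h4.symm)
  · by_cases e' : ℓ.lo x = 4
    · exact .inr (ℓ.le_of (by rw [h4, e']))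
    · refine .inl (ℓ.le_of ?_)
      rw [h2]
      rw [Fin.ext_iff] at e e'
      rw [Fin.le_def] at h1 h3 ⊢
      simp at e' h1 h3 ⊢
      omega

/-- A lattice labelled as the first basic block, as an adjunct of a chain to a linear sum. -/
theorem exists_adjunct_orderIso (h : ℓ.LongSupport {(0, 2), (1, 3), (1, 4)})
    (hac : ℓ.vtx 1 ≤ ℓ.vtx 3) (hce : ℓ.vtx 3 < ℓ.vtx 4) :
    ∃ φ : Adjunct (Set.Iic (ℓ.vtx 3) ⊕ₗ Set.Ioi (ℓ.vtx 3)) {x | ℓ.lo x = 1 ∧ ℓ.hi x = 4}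
        (Sum.inlₗ ⟨ℓ.vtx 1, hac⟩) (Sum.inrₗ ⟨ℓ.vtx 4, hce⟩) ≃o L,
      (∀ x : Set.Iic (ℓ.vtx 3), φ (Adjunct.inl (Sum.inlₗ x)) = x) ∧
      (∀ x : Set.Ioi (ℓ.vtx 3), φ (Adjunct.inl (Sum.inrₗ x)) = x) ∧
      ∀ x : {x | ℓ.lo x = 1 ∧ ℓ.hi x = 4}, φ (Adjunct.inr x) = x := by
  let g : Adjunct (Set.Iic (ℓ.vtx 3) ⊕ₗ Set.Ioi (ℓ.vtx 3)) {x | ℓ.lo x = 1 ∧ ℓ.hi x = 4}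
      (Sum.inlₗ ⟨ℓ.vtx 1, hac⟩) (Sum.inrₗ ⟨ℓ.vtx 4, hce⟩) → L :=
    Sum.elim (fun y => Sum.elim Subtype.val Subtype.val (ofLex y)) Subtype.val
  have hle : ∀ x y, g x ≤ g y ↔ x ≤ y := by
    rintro (x | ⟨x, hx, hx'⟩) (y | ⟨y, hy, hy'⟩)
    · obtain ⟨x | x, rfl⟩ := toLex.surjective x <;> obtain ⟨y | y, rfl⟩ := toLex.surjective y
      · exact (Sum.Lex.inl_le_inl_iff (a := x) (b := y)).symm
      · exact iff_of_true (x.2.trans y.2.le) (Sum.Lex.inl_le_inr _ _)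
      · exact iff_of_false (y.2.trans_lt x.2).not_ge Sum.Lex.not_inr_le_inl
      · exact (Sum.Lex.inr_le_inr_iff (a := x) (b := y)).symm
    · obtain ⟨x | x, rfl⟩ := toLex.surjective x
      · refine Iff.trans ⟨fun hxy => ?_, fun hxa => ?_⟩
          (Sum.Lex.inl_le_inl_iff (a := x) (b := ⟨ℓ.vtx 1, hac⟩)).symm
        -- An element below vertex 3 has `hi ≤ 3`, so it cannot share the label `(1, 4)`. Being
        -- below `y` thus means being below vertex 1.
        · rcases ℓ.of_le hxy with e | e
          · exact ℓ.le_vtx_iff.2 (e.trans hy.le)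
          · have := ℓ.le_vtx_iff.1 x.2
            have e2 : ℓ.hi x.1 = 4 := e.2.trans hy'
            rw [e2] at this
            exact absurd this (by decide)
        · exact le_trans (b := ℓ.vtx 1) hxa (ℓ.vtx_le_iff.2 hy.ge)
      · refine iff_of_false (fun hxy => ?_) Sum.Lex.not_inr_le_inl
        have h3 : 3 ≤ ℓ.lo y := (three_le_lo_of_vtx_lt (x.2.trans_le hxy)).1
        have h1 : ℓ.lo y = 1 := hy
        rw [h1] at h3
        exact absurd h3 (by decide)
    · obtain ⟨y | y, rfl⟩ := toLex.surjective y
      · refine iff_of_false (fun hxy => ?_) Sum.Lex.not_inr_le_inl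
        have h3 : ℓ.hi x ≤ 3 := ℓ.le_vtx_iff.1 (le_trans hxy y.2)
        have h4 : ℓ.hi x = 4 := hx'
        rw [h4] at h3
        exact absurd h3 (by decide)
      · refine Iff.trans ⟨fun hxy => ?_, fun hey => ?_⟩
          (Sum.Lex.inr_le_inr_iff (a := ⟨ℓ.vtx 4, hce⟩) (b := y)).symm
        · rcases ℓ.of_le hxy with e | e
          · exact ℓ.vtx_le_iff.2 (hx'.ge.trans e)
          · have := (three_le_lo_of_vtx_lt y.2).1
            have e2 : ℓ.lo y.1 = 1 := e.1.symm.trans hx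
            rw [e2] at this
            exact absurd this (by decide)
        · exact le_trans (b := ℓ.vtx 4) (ℓ.le_vtx_iff.2 hx'.le) hey
    · exact Iff.rfl
  have hinj : Function.Injective g := by
    rintro (x | x) (y | y) hxy
    · obtain ⟨x | x, rfl⟩ := toLex.surjective x <;> obtain ⟨y | y, rfl⟩ := toLex.surjective y
      · rw [show x = y from Subtype.ext hxy]
      · exact absurd (show x.1 = y.1 from hxy) (x.2.trans_lt y.2).ne
      · exact absurd (show x.1 = y.1 from hxy) (y.2.trans_lt x.2).ne'
      · rw [show x = y from Subtype.ext hxy]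
    · have h1 := (hle _ _).1 hxy.le
      have h2 := (hle _ _).1 hxy.ge
      obtain ⟨x | x, rfl⟩ := toLex.surjective x
      · exact absurd h2 Sum.Lex.not_inr_le_inl
      · exact absurd h1 Sum.Lex.not_inr_le_inl
    · have h1 := (hle _ _).1 hxy.le
      have h2 := (hle _ _).1 hxy.ge
      obtain ⟨y | y, rfl⟩ := toLex.surjective y
      · exact absurd h1 Sum.Lex.not_inr_le_inl
      · exact absurd h2 Sum.Lex.not_inr_le_inl
    · rw [show x = y from Subtype.ext hxy]
  have hsurj : Function.Surjective g := by
    intro x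
    by_cases h1 : x ≤ ℓ.vtx 3
    · exact ⟨Sum.inl (toLex (Sum.inl ⟨x, h1⟩)), rfl⟩
    have h4 : ℓ.hi x = 4 := by
      rw [ℓ.le_vtx_iff, Fin.le_def] at h1
      have := (ℓ.hi x).isLt
      exact Fin.ext (by simp at h1 ⊢; omega)
    by_cases h2 : 3 ≤ ℓ.lo x
    · exact ⟨Sum.inl (toLex (Sum.inr ⟨x, lt_of_le_not_ge (ℓ.vtx_le_iff.2 h2) h1⟩)), rfl⟩
    -- An element neither below nor above vertex 3 has `lo < 3` and `hi = 4`. Its label is long, and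
    -- `(1, 4)` is the only long pair ending at 4.
    · have h3 := (h (ℓ.lo x) 4).2 ⟨by rw [Fin.le_def] at h2; simp at h2 ⊢; omega, x, rfl, h4⟩
      have h5 : ∀ i : Fin 5, (i, (4 : Fin 5)) ∈
          ({(0, 2), (1, 3), (1, 4)} : Finset (Fin 5 × Fin 5)) → i = 1 := by decide
      exact ⟨Sum.inr ⟨x, h5 _ h3, h4⟩, rfl⟩
  exact ⟨⟨Equiv.ofBijective g ⟨hinj, hsurj⟩, hle _ _⟩, fun _ => rfl, fun _ => rfl, fun _ => rfl⟩

end Decomposition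

end IntervalLabelling

/-! ### The five counts and the decomposition. -/

theorem mainTheorem8 (j : ℕ) (hj : 8 ≤ j) :
    -- the common count for the five basic blocks
    (numBlocks BasicB₁ j =
      ∑ s ∈ Finset.Icc 1 (j - 7), ∑ t ∈ Finset.Icc 1 (j - s - 6), (j - t - s - 2).choose 4) ∧
    (numBlocks BasicB₂ j =
      ∑ s ∈ Finset.Icc 1 (j - 7), ∑ t ∈ Finset.Icc 1 (j - s - 6), (j - t - s - 2).choose 4) ∧
    (numBlocks BasicB₃ j =
      ∑ s ∈ Finset.Icc 1 (j - 7), ∑ t ∈ Finset.Icc 1 (j - s - 6), (j - t - s - 2).choose 4) ∧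
    (numBlocks BasicB₄ j =
      ∑ s ∈ Finset.Icc 1 (j - 7), ∑ t ∈ Finset.Icc 1 (j - s - 6), (j - t - s - 2).choose 4) ∧
    (numBlocks BasicB₅ j =
      ∑ s ∈ Finset.Icc 1 (j - 7), ∑ t ∈ Finset.Icc 1 (j - s - 6), (j - t - s - 2).choose 4) ∧
    -- the decomposition `L = (B' ⊕ C') ]_a^1 C₃` of the blocks with basic block `B₁`,
    -- where `B' = [0, c]` and `C' = (c, 1]`
    (∀ (L : Type u) [Lattice L], HasBasicBlock BasicB₁ j L →
      ∃ (o a b c e : L) (hac : a ≤ c) (hce : c < e) (C₃ : Set L) (i s t : ℕ),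
        IsBot o ∧ IsTop e ∧ o < a ∧ a < b ∧ b < c ∧ redSet L = {o, a, b, c, e} ∧
        6 ≤ i ∧ 1 ≤ s ∧ 1 ≤ t ∧ i + t + s = j ∧
        IsMaximalBlockOfHeight (Set.Iic c) i 4 2 3 ∧
        IsChain (· ≤ ·) (Set.Ioi c) ∧ (Set.Ioi c).ncard = t ∧
        IsChain (· ≤ ·) C₃ ∧ C₃.ncard = s ∧
        IsAdjunctPair (Sum.inlₗ ⟨a, hac⟩ : Set.Iic c ⊕ₗ Set.Ioi c) (Sum.inrₗ ⟨e, hce⟩) ∧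
        ∃ φ : Adjunct (Set.Iic c ⊕ₗ Set.Ioi c) C₃
            (Sum.inlₗ ⟨a, hac⟩) (Sum.inrₗ ⟨e, hce⟩) ≃o L,
          (∀ x : Set.Iic c, φ (Adjunct.inl (Sum.inlₗ x)) = x) ∧
          (∀ x : Set.Ioi c, φ (Adjunct.inl (Sum.inrₗ x)) = x) ∧
          (∀ x : C₃, φ (Adjunct.inr x) = x)) := by
  refine ⟨?_, ?_, ?_, ?_, ?_, ?_⟩
  iterate 5
    exact numBlocks_tripleAdjunct (by decide) (by decide) (by decide) (by decide) (by decide)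
      (by decide) (by decide) (by decide) (by decide) hj
  intro L _ hL
  have hcard : Nat.card L = j := hL.1.2.1
  obtain ⟨_, ℓ, hℓ⟩ := hL.exists_labelling (tripleAdjunct_longSupport (h₁ := by decide)
    (h₂ := by decide) (h₃ := by decide) (h₁₂ := by decide) (h₁₃ := by decide) (h₂₃ := by decide)
    (by decide) (by decide) (by decide))
  have hac : ℓ.vtx 1 ≤ ℓ.vtx 3 := ℓ.vtx_le_vtx.2 (by decide)
  have hce : ℓ.vtx 3 < ℓ.vtx 4 := ℓ.vtx_lt_vtx.2 (by decide)
  obtain ⟨hblock, h6⟩ := isMaximalBlockOfHeight_Iic hℓ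
  obtain ⟨φ, hφ⟩ := exists_adjunct_orderIso hℓ hac hce
  have hsum : Nat.card (Set.Iic (ℓ.vtx 3)) + (Set.Ioi (ℓ.vtx 3)).ncard +
      {x | ℓ.lo x = 1 ∧ ℓ.hi x = 4}.ncard = j := by
    rw [← hcard, ← Nat.card_congr φ.toEquiv, ← Nat.card_coe_set_eq, ← Nat.card_coe_set_eq,
      ← Nat.card_sum, ← Nat.card_sum]
    rfl
  refine ⟨ℓ.vtx 0, ℓ.vtx 1, ℓ.vtx 2, ℓ.vtx 3, ℓ.vtx 4, hac, hce, {x | ℓ.lo x = 1 ∧ ℓ.hi x = 4},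
    _, _, _, fun x => ℓ.vtx_le_iff.2 (Fin.zero_le _), fun x => ℓ.le_vtx_iff.2 (Fin.le_last _),
    ℓ.vtx_lt_vtx.2 (by decide), ℓ.vtx_lt_vtx.2 (by decide), ℓ.vtx_lt_vtx.2 (by decide), ?_, h6,
    ?_, ?_, hsum, hblock, isChain_Ioi_vtx, rfl, ?_, rfl, ?_, φ, hφ⟩
  · rw [redSet_eq hℓ (by unfold Spanning; decide)]
    ext x
    simp [Fin.exists_fin_succ, eq_comm]
  · obtain ⟨-, x, hx⟩ := (hℓ 1 4).1 (by decide)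
    exact (Set.ncard_pos (Set.toFinite _)).2 ⟨x, hx⟩
  · exact (Set.ncard_pos (Set.toFinite _)).2 ⟨_, hce⟩
  · intro x hx y hy _
    exact ℓ.total (hx.1.trans hy.1.symm) (hx.2.trans hy.2.symm)
  · refine ⟨Sum.Lex.inl_lt_inr _ _, fun hcov => ?_⟩
    -- The element `c` lies strictly between `a` and `1` in the linear sum, so the adjunct is taken
    -- at a noncovering pair.
    refine hcov.2 (c := Sum.inlₗ ⟨ℓ.vtx 3, le_rfl⟩) ?_ (Sum.Lex.inl_lt_inr _ _)
    exact Sum.Lex.inl_lt_inl_iff.2 (ℓ.vtx_lt_vtx.2 (by decide))
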